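/- **Setting.** $\Theta$ is a finite set of states, $\mu_0\in\Delta(\Theta)$ a prior, $A$ a set of actions, and $T\subset\mathbb R_+$ a nonempty compact set of times; $T^\circ=T\setminus\{\sup T\}$. The agent and the principal have bounded utilities $u,v:\Theta\times A\times T\to\mathbb R$. For $\mu\in\Delta(\Theta)$, $t\in T$ let $$U(\mu,t)=\max_{a\in A,\,s\ge t}\sum_\theta u(\theta,a,s)\mu(\theta),\qquad V(\mu,t)=\max\Big\{\sum_\theta v(\theta,a,s)\mu(\theta): (a,s)\text{ attains }U(\mu,t)\Big\},$$ where the maxima are assumed to be attained and $V$ to be Borel measurable. Extend $U(\cdot,t)$ to $\mathbb R_+^{\Theta}$ homogeneously of degree one. Let $D=\Delta(\Theta)\times T$ and let $\Delta_{\mu_0}$ be the set of Borel probability measures $f$ on $D$ with $\mathbb E_f[\mu]=\mu_0$. The reduced problem is $$\text{(R)}\quad \sup_{f\in\Delta_{\mu_0}}\mathbb E_f[V]\quad\text{s.t.}\quad \text{(OC-C)}\ \int_{\tau>t}U(\mu,\tau)\,f(d\mu,d\tau)\ \ge\ U\Big(\int_{\tau>t}\mu\, f(d\mu,d\tau),\,t\Big)\quad\forall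 t\in T^\circ .$$ For a finite positive Borel measure $\Lambda$ on $T^\circ$ put $$\mathcal L(f,\Lambda)=\mathbb E_f[V]+\int_{T^\circ}\Big(\int_{\tau>t}U(\mu,\tau)\,f(d\mu,d\tau)-U\Big(\int_{\tau>t}\mu\, f(d\mu,d\tau),t\Big)\Big)\,d\Lambda(t).$$ Let $\hat\mu_t=\mathbb E_f[\mu\mid\tau>t]$, with $\hat\mu_t=0$ if $f(\tau>t)=0$. A selection is a $\Lambda$-integrable map $t\mapsto\gamma_t$ on $T^\circ$ such that, for every $t$, $\gamma_t$ is a subgradient of $U(\cdot,t)$ on $\mathbb R_+^\Theta$ at $\hat\mu_t$. Given a selection and with $\Lambda(t)=\Lambda(\{\tau<t\})$, let $$l_{f,\Lambda}(\mu,t)=V(\mu,t)+\Lambda(t)U(\mu,t)-\Big(\int_{\tau<t}\gamma_\tau\,d\Lambda(\tau)\Big)\cdot\mu .$$ For $a\in\mathbb R^\Theta$ the first-order condition is $$\text{(FOC)}\qquad l_{f,\Lambda}(\mu,t)\le a\cdot\mu\ \text{ for all }(\mu,t)\in D,\ \text{ with equality for } f\text{-almost every }(\mu,t).$$ **Theorem.**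 *Sufficiency.* If $f\in\Delta_{\mu_0}$ satisfies (OC-C) and there are $\Lambda$, $a\in\mathbb R^\Theta$ and a selection of subgradients such that (FOC) and the complementary slackness condition $\mathcal L(f,\Lambda)=\mathbb E_f[V]$ hold, then $f$ solves (R). *Necessity.* Suppose that $T$ is finite or a compact interval, that $\mu_0$ has full support, and that: 1. $\sum_\theta\mu_0(\theta)U(\delta_\theta,t)>U(\mu_0,t)$ for all $t\in T$; and, if $T$ is finite, also for every $t\in T^\circ$ there is $s\in T$, $s>t$, with $\sum_\theta\mu_0(\theta)U(\delta_\theta,s)>U(\mu_0,t)$; 2. $U$ is continuous in $(\mu,t)$, $V$ is upper semicontinuous in $(\mu,t)$, and $\{V(\mu,\cdot)\}_{\mu\in\Delta(\Theta)}$ is equicontinuous on $T$. Then for every $f$ solving (R) there are $\Lambda$, $a\in\mathbb R^\Theta$ and a selection of subgradients such that (FOC) and $\mathcal L(f,\Lambda)=\mathbb E_f[V]$ hold and $\Lambda$ solves the dual problem, i.e. $\Lambda$ attains the minimum on the right of $$\sup_{f'\in\Delta_{\mu_0}}\inf_{\Lambda'}\mathcal L(f',\Lambda')=\min_{\Lambda'}\sup_{f'\in\Delta_{\mu_0}}\mathcal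 L(f',\Lambda'),$$ and this equality holds. Moreover, the equality $l_{f,\Lambda}(\mu,t)=a\cdot\mu$ holds at every point $(\mu,t)$ of the topological support of $f$ if $T$ is finite, and at every such point with $\Lambda(\{t\})=0$ if $T$ is an interval. -/

import Mathlib

open MeasureTheory Set

noncomputable section

namespace DynamicPersuasion

/-- The primitives of a dynamic persuasion problem: a compact nonempty time space `T ⊆ ℝ₊`,
a prior over the finite state space `Θ`, and bounded utilities `u` (agent) and `v` (principal)
depending on the state, the action and the time at which the action is taken.
The last field says that the maxima over actions and action times which define the indirect
utilities are attained: at every belief `μ` and time `t` the agent has a best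
`(action, time ≥ t)` pair, and among these best pairs there is one that is best for the
principal. -/
structure Model (Θ A : Type*) [Fintype Θ] where
  T : Set ℝ
  isCompact_T : IsCompact T
  nonempty_T : T.Nonempty
  nonneg_T : ∀ t ∈ T, 0 ≤ t
  prior : stdSimplex ℝ Θ
  u : Θ → A → T → ℝ
  v : Θ → A → T → ℝ
  bounded : ∃ C : ℝ, ∀ θ a t, |u θ a t| ≤ C ∧ |v θ a t| ≤ C
  max_attained : ∀ (μ : stdSimplex ℝ Θ) (t : T), ∃ (a : A) (s : T), t ≤ s ∧
    (∀ (a' : A) (s' : T), t ≤ s' → ∑ θ, u θ a' s' * μ θ ≤ ∑ θ, u θ a s * μ θ) ∧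
    (∀ (a' : A) (s' : T), t ≤ s' →
      ∑ θ, u θ a' s' * μ θ = ∑ θ, u θ a s * μ θ →
      ∑ θ, v θ a' s' * μ θ ≤ ∑ θ, v θ a s * μ θ)

variable {Θ A : Type*} [Fintype Θ]

namespace Model

/-- The belief-time space `D = Δ(Θ) × T`. -/
abbrev D (M : Model Θ A) : Type _ := stdSimplex ℝ Θ × M.T

/-- The time space without its last point, `T° = T \ {sup T}`. -/
def Tcirc (M : Model Θ A) : Set M.T := {t | (t : ℝ) ≠ sSup M.T}

/-- The agent's indirect utility `U(μ, t)`: the maximum over `a ∈ A` and `s ≥ t` of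
`∑ θ, u(θ, a, s) μ(θ)`. (It is used at probability vectors `μ`.) -/
def U (M : Model Θ A) (μ : Θ → ℝ) (t : M.T) : ℝ :=
  ⨆ q : A × {s : M.T // t ≤ s}, ∑ θ, M.u θ q.1 q.2 * μ θ

/-- The agent's optimal pairs `(a, s)` with `s ≥ t` at belief `μ`. -/
def bestReplies (M : Model Θ A) (μ : Θ → ℝ) (t : M.T) : Set (A × {s : M.T // t ≤ s}) :=
  {q | ∀ q' : A × {s : M.T // t ≤ s},
    ∑ θ, M.u θ q'.1 q'.2 * μ θ ≤ ∑ θ, M.u θ q.1 q.2 * μ θ}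

/-- The principal's indirect utility `V(μ, t)`: the maximum of `∑ θ, v(θ, a, s) μ(θ)` over the
agent's optimal pairs `(a, s)`. -/
def V (M : Model Θ A) (μ : Θ → ℝ) (t : M.T) : ℝ :=
  ⨆ q : M.bestReplies μ t, ∑ θ, M.v θ q.1.1 q.1.2 * μ θ

/-- The extension of `U(·, t)` from `Δ(Θ)` to the nonnegative orthant, homogeneous of
degree one: `U(x, t) = |x| U(x / |x|, t)` with `|x| = ∑ θ, x(θ)`, and `U(0, t) = 0`. -/
def Uext (M : Model Θ A) (x : Θ → ℝ) (t : M.T) : ℝ :=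
  (∑ θ, x θ) * M.U ((∑ θ, x θ)⁻¹ • x) t

/-- The full-information value `𝔼_μ₀[U(δ_θ, t)]`. -/
def fullInfoValue (M : Model Θ A) (t : M.T) : ℝ :=
  open Classical in ∑ θ, M.prior θ * M.U (Pi.single θ 1) t

/-- Information is strictly valuable at every time. -/
def InfoValuable (M : Model Θ A) : Prop :=
  ∀ t : M.T, M.U M.prior t < M.fullInfoValue t

/-- Waiting for information is strictly valuable: before the last time, the agent strictly
prefers being fully informed at some later time to acting now on the prior. -/
def WaitingValuable (M : Model Θ A) : Prop :=
  ∀ t ∈ M.Tcirc, ∃ s : M.T, t < s ∧ M.U M.prior t < M.fullInfoValue s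

/-- `U` is continuous and `V` is upper semicontinuous in `(μ, t)`, and the functions
`V(μ, ·) : T → ℝ`, `μ ∈ Δ(Θ)`, are equicontinuous. -/
def Continuity (M : Model Θ A) : Prop :=
  Continuous (fun p : M.D => M.U p.1 p.2) ∧
  UpperSemicontinuous (fun p : M.D => M.V p.1 p.2) ∧
  Equicontinuous (fun (μ : stdSimplex ℝ Θ) (t : M.T) => M.V μ t)

/-- Belief-time distributions `f ∈ Δ(D)` consistent with the prior: `𝔼_f[μ] = μ₀`. -/
def consistent (M : Model Θ A) : Set (ProbabilityMeasure M.D) :=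
  {f | ∀ θ, ∫ p : M.D, p.1 θ ∂(f : Measure M.D) = M.prior θ}

/-- The event `τ > t`. -/
def after (M : Model Θ A) (t : M.T) : Set M.D := {p | t < p.2}

/-- The vector `∫_{τ > t} μ f(dμ, dτ)`. -/
def pooled (M : Model Θ A) (f : ProbabilityMeasure M.D) (t : M.T) : Θ → ℝ :=
  fun θ => ∫ p in M.after t, p.1 θ ∂(f : Measure M.D)

/-- `G(f)(t) = ∫_{τ > t} U(μ, τ) f(dμ, dτ) - U(∫_{τ > t} μ f(dμ, dτ), t)`. -/
def slack (M : Model Θ A) (f : ProbabilityMeasure M.D) (t : M.T) : ℝ :=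
  ∫ p in M.after t, M.U p.1 p.2 ∂(f : Measure M.D) - M.Uext (M.pooled f t) t

/-- The pooled obedience constraints. -/
def Obedient (M : Model Θ A) (f : ProbabilityMeasure M.D) : Prop :=
  ∀ t ∈ M.Tcirc,
    M.Uext (M.pooled f t) t ≤ ∫ p in M.after t, M.U p.1 p.2 ∂(f : Measure M.D)

/-- The principal's payoff `𝔼_f[V]`. -/
def payoff (M : Model Θ A) (f : ProbabilityMeasure M.D) : ℝ :=
  ∫ p, M.V p.1 p.2 ∂(f : Measure M.D)

/-- `f` solves the reduced problem: it maximizes `𝔼_f[V]` over the consistent belief-time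
distributions which satisfy the pooled obedience constraints. -/
def Solves (M : Model Θ A) (f : ProbabilityMeasure M.D) : Prop :=
  f ∈ M.consistent ∧ M.Obedient f ∧
    ∀ f' ∈ M.consistent, M.Obedient f' → M.payoff f' ≤ M.payoff f

/-- The Lagrangian `ℒ(f, Λ)`. Multipliers are finite positive Borel measures on `T°`. -/
def lagrangian (M : Model Θ A) (f : ProbabilityMeasure M.D) (Λ : FiniteMeasure M.Tcirc) : ℝ :=
  M.payoff f + ∫ t : M.Tcirc, M.slack f t ∂(Λ : Measure M.Tcirc)

/-- The dual objective `sup_f ℒ(f, Λ)`. -/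
def dualValue (M : Model Θ A) (Λ : FiniteMeasure M.Tcirc) : EReal :=
  ⨆ f ∈ M.consistent, (M.lagrangian f Λ : EReal)

/-- `Λ` solves `sup_f inf_Λ ℒ(f, Λ) = min_Λ sup_f ℒ(f, Λ)`: the equality holds and `Λ` attains
the minimum on the right. -/
def SolvesDual (M : Model Θ A) (Λ : FiniteMeasure M.Tcirc) : Prop :=
  (∀ Λ' : FiniteMeasure M.Tcirc, M.dualValue Λ ≤ M.dualValue Λ') ∧
  M.dualValue Λ =
    ⨆ f ∈ M.consistent, ⨅ Λ' : FiniteMeasure M.Tcirc, (M.lagrangian f Λ' : EReal)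

/-- The continuation belief `μ̂_t = 𝔼_f[μ | τ > t]`; it is `0` if `f(τ > t) = 0`. -/
def contBelief (M : Model Θ A) (f : ProbabilityMeasure M.D) (t : M.T) : Θ → ℝ :=
  ((f : Measure M.D).real (M.after t))⁻¹ • M.pooled f t

/-- `γ` is a subgradient at `x` of `U(·, t)` on the nonnegative orthant. -/
def IsSubgradient (M : Model Θ A) (t : M.T) (x γ : Θ → ℝ) : Prop :=
  ∀ y : Θ → ℝ, (∀ θ, 0 ≤ y θ) → M.Uext x t + ∑ θ, γ θ * (y θ - x θ) ≤ M.Uext y t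

/-- `γ` is a selection `t ↦ γ_t` of subgradients of `U(·, t)` at the continuation beliefs
`μ̂_t` of `f` which can be integrated against `Λ`. -/
def IsSelection (M : Model Θ A) (f : ProbabilityMeasure M.D) (Λ : FiniteMeasure M.Tcirc)
    (γ : M.Tcirc → Θ → ℝ) : Prop :=
  (∀ t : M.Tcirc, M.IsSubgradient t (M.contBelief f t) (γ t)) ∧
  ∀ θ, Integrable (fun t => γ t θ) (Λ : Measure M.Tcirc)

/-- The times of `T°` strictly before `t`. -/
def before (M : Model Θ A) (t : M.T) : Set M.Tcirc := {τ | (τ : M.T) < t}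

/-- The derivative of the Lagrangian, for the selection `γ` of subgradients at the continuation
beliefs of `f`:
`l(μ, t) = V(μ, t) + Λ(t) U(μ, t) - (∫_{τ < t} γ_τ dΛ(τ)) · μ`, where `Λ(t) = Λ({τ < t})`. -/
def deriv (M : Model Θ A) (Λ : FiniteMeasure M.Tcirc) (γ : M.Tcirc → Θ → ℝ) (p : M.D) : ℝ :=
  M.V p.1 p.2 + (Λ : Measure M.Tcirc).real (M.before p.2) * M.U p.1 p.2
    - ∑ θ, (∫ τ in M.before p.2, γ τ θ ∂(Λ : Measure M.Tcirc)) * p.1 θ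

/-- The first-order condition: `l(μ, t) ≤ a · μ` on `D`, with equality `f`-almost everywhere. -/
def FOC (M : Model Θ A) (f : ProbabilityMeasure M.D) (Λ : FiniteMeasure M.Tcirc)
    (γ : M.Tcirc → Θ → ℝ) (a : Θ → ℝ) : Prop :=
  (∀ p : M.D, M.deriv Λ γ p ≤ ∑ θ, a θ * p.1 θ) ∧
  ∀ᵐ p ∂(f : Measure M.D), M.deriv Λ γ p = ∑ θ, a θ * p.1 θ

end Model

end DynamicPersuasion

end

/-!
*Sufficiency* is weak duality. By homogeneity a subgradient `γ_t` of `U(·, t)` at the continuation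
belief is a linear form below `U(·, t)` which agrees with it at the pooled mass. Fubini's theorem
(`integral_deriv`) turns `∫ l df'` into the Lagrangian with `U(·, t)` replaced by `γ_t`; hence
`𝔼_f'[V] ≤ ℒ(f', Λ) ≤ ∫ l df' ≤ a · μ₀` for every feasible `f'`, with equalities at `f`.

*Necessity* reduces to finding `Λ`, linear forms `γ_t ≤ U(·, t)` for `Λ`-almost every `t`, and `a`,
with `l ≤ a · μ` on `D` and `a · μ₀ ≤ 𝔼_f[V]`: the chain
`𝔼_f[V] ≤ ℒ(f, Λ) ≤ ∫ l df ≤ a · μ₀ ≤ 𝔼_f[V]` then collapses, and its links are complementary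
slackness, the subgradient property and the equality in the first-order condition
(`conclusion_of_multipliers`). In particular no compactness of the space of belief-time
distributions is needed, and only finitely supported measures compete with `f`.

All the multipliers come from one application of the M. Riesz extension theorem
(`exists_isMultiplier`). The problem for finitely supported measures is perturbed in its consistency
constraint, in its obedience constraints, and in the argument of `U(·, t)` in each of these. The
multipliers of the three perturbations are `a`, a positive functional `lam` on the bounded functions
on `T°`, and a functional `Γ` which plays the role of `γ dΛ` and is dominated by `lam` through
`Γ(y) ≤ lam(t ↦ U(y(t), t))`. The extension theorem needs Slater's condition. It is met by revealing
the state at the dates of a finite grid with rapidly decreasing weights, so that the value of the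
next revelation outweighs whatever happens later (`slater_of_grid`).

It remains to represent `lam` and `Γ` by measures. For finite `T` they are sums of point masses. If
`T` is an interval, `Λ` is the Stieltjes measure of `r ↦ lam 1_{t < r}`, and `γ` is the density of
`r ↦ Γ 1_{t < r}` with respect to it; `γ_t ≤ U(·, t)` follows from the domination by
the differentiation theorem for measures (`exists_density`), and `l ≤ a · μ` by taking left limits
in time, which is where the equicontinuity of `V` enters.
-/

noncomputable section

namespace DynamicPersuasion

variable {Θ A : Type*} [Fintype Θ]

namespace Model

/-! ### The indirect utilities -/

/-- A common bound on the absolute values of the two utilities. -/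
def bd (M : Model Θ A) : ℝ := M.bounded.choose

lemma abs_u_le (M : Model Θ A) (θ : Θ) (a : A) (t : M.T) : |M.u θ a t| ≤ M.bd :=
  (M.bounded.choose_spec θ a t).1

lemma abs_v_le (M : Model Θ A) (θ : Θ) (a : A) (t : M.T) : |M.v θ a t| ≤ M.bd :=
  (M.bounded.choose_spec θ a t).2

lemma nonempty_states (M : Model Θ A) : Nonempty Θ := by
  by_contra h
  rw [not_nonempty_iff] at h
  simpa using M.prior.2.2

lemma nonempty_actions (M : Model Θ A) : Nonempty A := by
  obtain ⟨t, ht⟩ := M.nonempty_T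
  obtain ⟨a, -⟩ := M.max_attained M.prior ⟨t, ht⟩
  exact ⟨a⟩

lemma bd_nonneg (M : Model Θ A) : 0 ≤ M.bd := by
  obtain ⟨t, ht⟩ := M.nonempty_T
  obtain ⟨θ⟩ := M.nonempty_states
  obtain ⟨a⟩ := M.nonempty_actions
  exact (abs_nonneg _).trans (M.abs_u_le θ a ⟨t, ht⟩)

lemma abs_sum_mul_le {w x : Θ → ℝ} {C : ℝ} (hw : ∀ θ, |w θ| ≤ C) :
    |∑ θ, w θ * x θ| ≤ C * ∑ θ, |x θ| := by
  rw [Finset.mul_sum]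
  refine (Finset.abs_sum_le_sum_abs _ _).trans (Finset.sum_le_sum fun θ _ => ?_)
  rw [abs_mul]
  exact mul_le_mul_of_nonneg_right (hw θ) (abs_nonneg _)

lemma sum_simplex (μ : stdSimplex ℝ Θ) : ∑ θ, μ θ = 1 := μ.2.2

lemma sum_abs_simplex (μ : stdSimplex ℝ Θ) : ∑ θ, |μ θ| = 1 := by
  rw [← μ.2.2]
  exact Finset.sum_congr rfl fun θ _ => abs_of_nonneg (μ.2.1 θ)

lemma bddAbove_U (M : Model Θ A) (x : Θ → ℝ) (t : M.T) :
    BddAbove (range fun q : A × {s : M.T // t ≤ s} => ∑ θ, M.u θ q.1 q.2 * x θ) := by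
  refine ⟨M.bd * ∑ θ, |x θ|, ?_⟩
  rintro _ ⟨q, rfl⟩
  exact (le_abs_self _).trans (abs_sum_mul_le fun θ => M.abs_u_le θ q.1 q.2)

variable {M : Model Θ A}

lemma le_U (x : Θ → ℝ) {t s : M.T} (h : t ≤ s) (a : A) : ∑ θ, M.u θ a s * x θ ≤ M.U x t :=
  le_ciSup (M.bddAbove_U x t) (a, ⟨s, h⟩)

lemma U_le {x : Θ → ℝ} {t : M.T} {c : ℝ}
    (h : ∀ (a : A) (s : M.T), t ≤ s → ∑ θ, M.u θ a s * x θ ≤ c) : M.U x t ≤ c := by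
  have := M.nonempty_actions
  have : Nonempty {s : M.T // t ≤ s} := ⟨⟨t, le_rfl⟩⟩
  exact ciSup_le fun q => h q.1 q.2 q.2.2

lemma abs_U_le (x : Θ → ℝ) (t : M.T) : |M.U x t| ≤ M.bd * ∑ θ, |x θ| := by
  obtain ⟨a⟩ := M.nonempty_actions
  rw [abs_le]
  constructor
  · exact (neg_le_of_abs_le (abs_sum_mul_le fun θ => M.abs_u_le θ a t)).trans (le_U x le_rfl a)
  · exact U_le fun a s _ => (le_abs_self _).trans (abs_sum_mul_le fun θ => M.abs_u_le θ a s)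

lemma abs_U_simplex_le (μ : stdSimplex ℝ Θ) (t : M.T) : |M.U μ t| ≤ M.bd := by
  have := abs_U_le (M := M) μ t
  rwa [sum_abs_simplex, mul_one] at this

lemma U_add_le (x y : Θ → ℝ) (t : M.T) : M.U (x + y) t ≤ M.U x t + M.U y t := by
  refine U_le fun a s h => ?_
  simp only [Pi.add_apply, mul_add, Finset.sum_add_distrib]
  exact add_le_add (le_U x h a) (le_U y h a)

lemma U_smul {c : ℝ} (hc : 0 ≤ c) (x : Θ → ℝ) (t : M.T) : M.U (c • x) t = c * M.U x t := by
  unfold U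
  rw [Real.mul_iSup_of_nonneg hc]
  congr 1
  ext q
  simp only [Pi.smul_apply, smul_eq_mul, Finset.mul_sum]
  exact Finset.sum_congr rfl fun θ _ => by ring

@[simp] lemma U_zero (t : M.T) : M.U 0 t = 0 := by
  simpa using U_smul (M := M) le_rfl 0 t

lemma U_sub_le (x y : Θ → ℝ) (t : M.T) : M.U x t - M.U y t ≤ M.bd * ∑ θ, |x θ - y θ| := by
  have h1 := U_add_le (M := M) y (x - y) t
  have h2 := (le_abs_self _).trans (abs_U_le (M := M) (x - y) t)
  rw [add_sub_cancel] at h1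
  simp only [Pi.sub_apply] at h2
  linarith

lemma U_le_U_of_le (x : Θ → ℝ) {s t : M.T} (h : s ≤ t) : M.U x t ≤ M.U x s :=
  U_le fun a _ hr => le_U x (h.trans hr) a

lemma continuous_U (t : M.T) : Continuous fun x : Θ → ℝ => M.U x t := by
  rw [continuous_iff_continuousAt]
  intro x
  rw [ContinuousAt, tendsto_iff_norm_sub_tendsto_zero]
  have hlim : Filter.Tendsto (fun y : Θ → ℝ => M.bd * ∑ θ, |y θ - x θ|) (nhds x) (nhds 0) := by
    have : Continuous fun y : Θ → ℝ => M.bd * ∑ θ, |y θ - x θ| := by fun_prop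
    simpa using this.tendsto x
  refine squeeze_zero (fun _ => norm_nonneg _) (fun y => ?_) hlim
  rw [Real.norm_eq_abs, abs_le]
  have h := U_sub_le (M := M) x y t
  simp only [abs_sub_comm (x _)] at h
  exact ⟨by linarith, U_sub_le y x t⟩

/-- `U` is jointly measurable without any continuity in time, because it is continuous in the
belief and antitone in time. -/
lemma measurable_U : Measurable fun p : (Θ → ℝ) × M.T => M.U p.1 p.2 := by
  have h : StronglyMeasurable
      (Function.uncurry fun (x : Θ → ℝ) (t : M.T) => M.U x t) :=
    stronglyMeasurable_uncurry_of_continuous_of_stronglyMeasurable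
      (u := fun (x : Θ → ℝ) (t : M.T) => M.U x t) (fun t => continuous_U t)
      (fun x => (Antitone.measurable fun _ _ h => U_le_U_of_le x h).stronglyMeasurable)
  exact h.measurable

lemma Uext_eq_U {x : Θ → ℝ} (hx : ∀ θ, 0 ≤ x θ) (t : M.T) : M.Uext x t = M.U x t := by
  have hs : 0 ≤ ∑ θ, x θ := Finset.sum_nonneg fun θ _ => hx θ
  rcases hs.eq_or_lt with h | h
  · have : x = 0 := by
      ext θ
      exact (Finset.sum_eq_zero_iff_of_nonneg fun θ _ => hx θ).1 h.symm θ (Finset.mem_univ θ)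
    subst this
    simp [Uext]
  · rw [Uext, U_smul (inv_nonneg.2 hs), mul_inv_cancel_left₀ h.ne']

lemma abs_V_le (μ : stdSimplex ℝ Θ) (t : M.T) : |M.V μ t| ≤ M.bd := by
  have hb : ∀ q : M.bestReplies μ t, |∑ θ, M.v θ q.1.1 q.1.2 * μ θ| ≤ M.bd := fun q => by
    have := abs_sum_mul_le (x := μ) fun θ => M.abs_v_le θ q.1.1 q.1.2
    rwa [sum_abs_simplex, mul_one] at this
  obtain ⟨a, s, hs, h1, -⟩ := M.max_attained μ t
  have q : M.bestReplies μ t := ⟨(a, ⟨s, hs⟩), fun q' => h1 q'.1 q'.2 q'.2.2⟩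
  have : Nonempty (M.bestReplies μ t) := ⟨q⟩
  rw [abs_le]
  constructor
  · refine (abs_le.1 (hb q)).1.trans (le_ciSup (f := fun q : M.bestReplies μ t =>
      ∑ θ, M.v θ q.1.1 q.1.2 * μ θ) ⟨M.bd, ?_⟩ q)
    rintro _ ⟨q, rfl⟩
    exact (abs_le.1 (hb q)).2
  · exact ciSup_le fun q => (abs_le.1 (hb q)).2

/-! ### Subgradients of a support function -/

/-- By homogeneity, the subgradients of `U(·, t)` at `x` are the linear forms below `U(·, t)`
that agree with it at `x`. -/
lemma isSubgradient_iff {t : M.T} {x γ : Θ → ℝ} (hx : ∀ θ, 0 ≤ x θ) :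
    M.IsSubgradient t x γ ↔
      ∑ θ, γ θ * x θ = M.U x t ∧ ∀ y : Θ → ℝ, (∀ θ, 0 ≤ y θ) → ∑ θ, γ θ * y θ ≤ M.U y t := by
  have hexp : ∀ y : Θ → ℝ, ∑ θ, γ θ * (y θ - x θ) = ∑ θ, γ θ * y θ - ∑ θ, γ θ * x θ := fun y => by
    simp only [mul_sub, Finset.sum_sub_distrib]
  constructor
  · intro h
    have h0 := h 0 fun _ => le_rfl
    have h2 := h ((2 : ℝ) • x) fun θ => mul_nonneg zero_le_two (hx θ)
    rw [hexp, Uext_eq_U hx, Uext_eq_U (x := 0) fun θ => le_rfl, U_zero] at h0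
    rw [hexp, Uext_eq_U hx, Uext_eq_U (x := (2 : ℝ) • x) fun θ => mul_nonneg zero_le_two (hx θ),
      U_smul zero_le_two] at h2
    have e : ∑ θ, γ θ * ((2 : ℝ) • x) θ = 2 * ∑ θ, γ θ * x θ := by
      rw [Finset.mul_sum]
      exact Finset.sum_congr rfl fun θ _ => by simp; ring
    simp only [Pi.zero_apply, mul_zero, Finset.sum_const_zero] at h0
    have heq : ∑ θ, γ θ * x θ = M.U x t := by linarith
    refine ⟨heq, fun y hy => ?_⟩
    have := h y hy
    rw [hexp, Uext_eq_U hx, Uext_eq_U hy] at this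
    linarith
  · rintro ⟨h1, h2⟩ y hy
    rw [hexp, Uext_eq_U hx, Uext_eq_U hy]
    linarith [h2 y hy]

/-- Best replies provide subgradients, as the maximum defining `U` is attained. -/
lemma exists_isSubgradient {x : Θ → ℝ} (hx : ∀ θ, 0 ≤ x θ) (t : M.T) :
    ∃ γ, M.IsSubgradient t x γ := by
  have key : ∃ (a : A) (s : M.T), t ≤ s ∧ ∑ θ, M.u θ a s * x θ = M.U x t := by
    have hs : 0 ≤ ∑ θ, x θ := Finset.sum_nonneg fun θ _ => hx θ
    rcases hs.eq_or_lt with h | h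
    · have : x = 0 := by
        ext θ
        exact (Finset.sum_eq_zero_iff_of_nonneg fun θ _ => hx θ).1 h.symm θ (Finset.mem_univ θ)
      obtain ⟨a⟩ := M.nonempty_actions
      exact ⟨a, t, le_rfl, by simp [this]⟩
    · let μ : stdSimplex ℝ Θ := ⟨(∑ θ, x θ)⁻¹ • x, fun θ => mul_nonneg (inv_nonneg.2 hs) (hx θ), by
        simp [← Finset.mul_sum, inv_mul_cancel₀ h.ne']⟩
      obtain ⟨a, s, hts, h1, -⟩ := M.max_attained μ t
      refine ⟨a, s, hts, (le_U x hts a).antisymm (U_le fun a' s' h' => ?_)⟩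
      have h2 : ∀ a s, ∑ θ, M.u θ a s * μ θ = (∑ θ, x θ)⁻¹ * ∑ θ, M.u θ a s * x θ := fun a s => by
        rw [Finset.mul_sum]
        refine Finset.sum_congr rfl fun θ _ => ?_
        change M.u θ a s * ((∑ θ, x θ)⁻¹ * x θ) = _
        ring
      have h3 := h1 a' s' h'
      rw [h2, h2] at h3
      exact le_of_mul_le_mul_left h3 (inv_pos.2 h)
  obtain ⟨a, s, hts, h⟩ := key
  exact ⟨fun θ => M.u θ a s, (isSubgradient_iff hx).2 ⟨h, fun y _ => le_U y hts a⟩⟩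

/-! ### The Lagrangian and its linearization -/

lemma measurableSet_after (t : M.T) : MeasurableSet (M.after t) :=
  measurableSet_lt measurable_const measurable_snd

lemma measurableSet_before (t : M.T) : MeasurableSet (M.before t) :=
  measurableSet_lt measurable_subtype_coe measurable_const

lemma measurable_coord (θ : Θ) : Measurable fun p : M.D => p.1 θ :=
  (measurable_pi_apply θ).comp (measurable_subtype_coe.comp measurable_fst)

lemma abs_coord_le (μ : stdSimplex ℝ Θ) (θ : Θ) : |μ θ| ≤ 1 := by
  rw [← sum_abs_simplex μ]
  exact Finset.single_le_sum (f := fun θ => |μ θ|) (fun _ _ => abs_nonneg _) (Finset.mem_univ θ)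

lemma measurable_U_belief : Measurable fun p : M.D => M.U p.1 p.2 :=
  measurable_U.comp ((measurable_subtype_coe.comp measurable_fst).prodMk measurable_snd)

lemma integrable_of_abs_le (f : ProbabilityMeasure M.D) {h : M.D → ℝ} (hm : Measurable h)
    {C : ℝ} (hC : ∀ p, |h p| ≤ C) : Integrable h (f : Measure M.D) :=
  (integrable_const C).mono' hm.aestronglyMeasurable (Filter.Eventually.of_forall hC)

lemma integrable_coord (f : ProbabilityMeasure M.D) (θ : Θ) :
    Integrable (fun p : M.D => p.1 θ) (f : Measure M.D) :=
  integrable_of_abs_le f (measurable_coord θ) fun p => abs_coord_le p.1 θ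

/-- Exchanging the order of integration over the pairs `t < τ`, where `t` is distributed according
to the multiplier and `τ` is the time of a belief-time pair. -/
lemma integral_before_mul (f : ProbabilityMeasure M.D) (Λ : FiniteMeasure M.Tcirc)
    {h : M.D → ℝ} (hm : Measurable h) {C : ℝ} (hC : ∀ p, |h p| ≤ C)
    {g : M.Tcirc → ℝ} (hg : Integrable g (Λ : Measure M.Tcirc)) :
    Integrable (fun p : M.D => (∫ t in M.before p.2, g t ∂(Λ : Measure M.Tcirc)) * h p)
      (f : Measure M.D) ∧
    Integrable (fun t : M.Tcirc => g t * ∫ p in M.after t, h p ∂(f : Measure M.D))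
      (Λ : Measure M.Tcirc) ∧
    ∫ p, (∫ t in M.before p.2, g t ∂(Λ : Measure M.Tcirc)) * h p ∂(f : Measure M.D) =
      ∫ t, g t * ∫ p in M.after t, h p ∂(f : Measure M.D) ∂(Λ : Measure M.Tcirc) := by
  let S : Set (M.D × M.Tcirc) := {q | (q.2 : M.T) < q.1.2}
  have hS : MeasurableSet S :=
    measurableSet_lt (measurable_subtype_coe.comp measurable_snd)
      (measurable_snd.comp measurable_fst)
  let F : M.D → M.Tcirc → ℝ := fun p t => S.indicator (fun q => h q.1 * g q.2) (p, t)
  have hF : Integrable (Function.uncurry F) ((f : Measure M.D).prod (Λ : Measure M.Tcirc)) :=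
    ((integrable_of_abs_le f hm hC).mul_prod hg).indicator hS
  have h1 : ∀ p, ∫ t, F p t ∂(Λ : Measure M.Tcirc) =
      (∫ t in M.before p.2, g t ∂(Λ : Measure M.Tcirc)) * h p := fun p => by
    rw [mul_comm, ← integral_const_mul, ← integral_indicator (measurableSet_before _)]
    rfl
  have h2 : ∀ t, ∫ p, F p t ∂(f : Measure M.D) =
      g t * ∫ p in M.after t, h p ∂(f : Measure M.D) := fun t => by
    rw [mul_comm, ← integral_mul_const, ← integral_indicator (measurableSet_after _)]
    rfl
  refine ⟨?_, ?_, ?_⟩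
  · simpa only [Function.uncurry, h1] using hF.integral_prod_left
  · simpa only [Function.uncurry, h2] using hF.integral_prod_right
  · simpa only [h1, h2] using integral_integral_swap hF

lemma pooled_nonneg (f : ProbabilityMeasure M.D) (t : M.T) (θ : Θ) : 0 ≤ M.pooled f t θ :=
  integral_nonneg fun p => p.1.2.1 θ

lemma slack_eq (f : ProbabilityMeasure M.D) (t : M.T) :
    M.slack f t = ∫ p in M.after t, M.U p.1 p.2 ∂(f : Measure M.D) - M.U (M.pooled f t) t := by
  rw [slack, Uext_eq_U (pooled_nonneg f t)]

lemma integrable_gain (f : ProbabilityMeasure M.D) (Λ : FiniteMeasure M.Tcirc) :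
    Integrable (fun t : M.Tcirc => ∫ p in M.after t, M.U p.1 p.2 ∂(f : Measure M.D))
      (Λ : Measure M.Tcirc) := by
  simpa using (integral_before_mul f Λ measurable_U_belief
    (fun p => abs_U_simplex_le p.1 p.2) (integrable_const 1)).2.1

lemma integrable_U_pooled (f : ProbabilityMeasure M.D) (Λ : FiniteMeasure M.Tcirc) :
    Integrable (fun t : M.Tcirc => M.U (M.pooled f t) t) (Λ : Measure M.Tcirc) := by
  have hp : ∀ θ, Integrable (fun t : M.Tcirc => M.pooled f t θ) (Λ : Measure M.Tcirc) :=
    fun θ => by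
      simpa [pooled] using (integral_before_mul f Λ (measurable_coord θ)
        (fun p => abs_coord_le p.1 θ) (integrable_const 1)).2.1
  have hmeas : ∀ θ, Measurable fun t : M.T => M.pooled f t θ := fun θ =>
    Antitone.measurable fun s t hst => setIntegral_mono_set (integrable_coord f θ).integrableOn
      (Filter.Eventually.of_forall fun p => p.1.2.1 θ)
      (LE.le.eventuallyLE fun p (hp : t < p.2) => lt_of_le_of_lt hst hp)
  refine ((integrable_finsetSum Finset.univ fun θ _ => (hp θ).abs).const_mul M.bd).mono'
    ?_ (Filter.Eventually.of_forall fun t => abs_U_le _ _)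
  exact (measurable_U.comp ((measurable_pi_lambda _ fun θ =>
    (hmeas θ).comp measurable_subtype_coe).prodMk measurable_subtype_coe)).aestronglyMeasurable

lemma integrable_subgradient_pooled (f : ProbabilityMeasure M.D) {Λ : FiniteMeasure M.Tcirc}
    {γ : M.Tcirc → Θ → ℝ} (hγ : ∀ θ, Integrable (fun t => γ t θ) (Λ : Measure M.Tcirc)) :
    Integrable (fun t : M.Tcirc => ∑ θ, γ t θ * M.pooled f t θ) (Λ : Measure M.Tcirc) :=
  integrable_finsetSum _ fun θ _ =>
    (integral_before_mul f Λ (measurable_coord θ) (fun p => abs_coord_le p.1 θ) (hγ θ)).2.1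

lemma integrable_deriv (hV : Measurable fun p : M.D => M.V p.1 p.2) (f : ProbabilityMeasure M.D)
    {Λ : FiniteMeasure M.Tcirc} {γ : M.Tcirc → Θ → ℝ}
    (hγ : ∀ θ, Integrable (fun t => γ t θ) (Λ : Measure M.Tcirc)) :
    Integrable (M.deriv Λ γ) (f : Measure M.D) := by
  have h1 := integrable_of_abs_le f hV fun p => abs_V_le p.1 p.2
  have h2 := (integral_before_mul f Λ measurable_U_belief
    (fun p => abs_U_simplex_le p.1 p.2) (integrable_const 1)).1
  simp only [integral_const, smul_eq_mul, mul_one, measureReal_restrict_apply_univ] at h2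
  exact (h1.add h2).sub (integrable_finsetSum _ fun θ _ =>
    (integral_before_mul f Λ (measurable_coord θ) (fun p => abs_coord_le p.1 θ) (hγ θ)).1)

/-- Fubini's theorem identifies the integral of `l` with a Lagrangian in which `U(·, t)` has been
replaced by the linear form `γ_t`. -/
lemma integral_deriv (hV : Measurable fun p : M.D => M.V p.1 p.2) (f : ProbabilityMeasure M.D)
    {Λ : FiniteMeasure M.Tcirc} {γ : M.Tcirc → Θ → ℝ}
    (hγ : ∀ θ, Integrable (fun t => γ t θ) (Λ : Measure M.Tcirc)) :
    ∫ p, M.deriv Λ γ p ∂(f : Measure M.D) = M.payoff f +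
      ∫ t : M.Tcirc, (∫ p in M.after t, M.U p.1 p.2 ∂(f : Measure M.D) -
        ∑ θ, γ t θ * M.pooled f t θ) ∂(Λ : Measure M.Tcirc) := by
  have h1 := integrable_of_abs_le f hV fun p => abs_V_le p.1 p.2
  have h2 := integral_before_mul f Λ measurable_U_belief
    (fun p => abs_U_simplex_le p.1 p.2) (integrable_const 1)
  simp only [integral_const, smul_eq_mul, mul_one, one_mul,
    measureReal_restrict_apply_univ] at h2
  have h3 := fun θ => integral_before_mul f Λ (measurable_coord θ)
    (fun p => abs_coord_le p.1 θ) (hγ θ)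
  have e : ∫ p, M.deriv Λ γ p ∂(f : Measure M.D) = M.payoff f +
      ∫ p, (Λ : Measure M.Tcirc).real (M.before p.2) * M.U p.1 p.2 ∂(f : Measure M.D) -
      ∑ θ, ∫ p, (∫ τ in M.before p.2, γ τ θ ∂(Λ : Measure M.Tcirc)) * p.1 θ
        ∂(f : Measure M.D) := by
    rw [← integral_finsetSum _ fun θ _ => (h3 θ).1, payoff, ← integral_add h1 h2.1]
    exact integral_sub (h1.add h2.1) (integrable_finsetSum _ fun θ _ => (h3 θ).1)
  rw [e, integral_sub (integrable_gain f Λ) (integrable_subgradient_pooled f hγ), h2.2.2,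
    Finset.sum_congr rfl fun θ _ => (h3 θ).2.2, ← integral_finsetSum _ fun θ _ => (h3 θ).2.1]
  simp only [pooled]
  ring

lemma lagrangian_eq (f : ProbabilityMeasure M.D) (Λ : FiniteMeasure M.Tcirc) :
    M.lagrangian f Λ = M.payoff f + ∫ t : M.Tcirc,
      (∫ p in M.after t, M.U p.1 p.2 ∂(f : Measure M.D) - M.U (M.pooled f t) t)
        ∂(Λ : Measure M.Tcirc) := by
  simp only [lagrangian, slack_eq]

/-- Linearizing the Lagrangian along linear forms below `U(·, t)` can only increase it. -/
lemma lagrangian_le_integral_deriv (hV : Measurable fun p : M.D => M.V p.1 p.2)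
    (f : ProbabilityMeasure M.D) {Λ : FiniteMeasure M.Tcirc} {γ : M.Tcirc → Θ → ℝ}
    (hγ : ∀ θ, Integrable (fun t => γ t θ) (Λ : Measure M.Tcirc))
    (hle : ∀ᵐ t ∂(Λ : Measure M.Tcirc), ∀ y : Θ → ℝ, (∀ θ, 0 ≤ y θ) →
      ∑ θ, γ t θ * y θ ≤ M.U y t) :
    M.lagrangian f Λ ≤ ∫ p, M.deriv Λ γ p ∂(f : Measure M.D) := by
  rw [integral_deriv hV f hγ, lagrangian_eq]
  refine add_le_add le_rfl (integral_mono_ae ((integrable_gain f Λ).sub (integrable_U_pooled f Λ))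
    ((integrable_gain f Λ).sub (integrable_subgradient_pooled f hγ)) ?_)
  filter_upwards [hle] with t ht
  exact sub_le_sub_left (ht _ (pooled_nonneg f t)) _

lemma integral_linear (f : ProbabilityMeasure M.D) (hf : f ∈ M.consistent) (a : Θ → ℝ) :
    ∫ p : M.D, ∑ θ, a θ * p.1 θ ∂(f : Measure M.D) = ∑ θ, a θ * M.prior θ := by
  rw [integral_finsetSum _ fun θ _ => (integrable_coord f θ).const_mul _]
  exact Finset.sum_congr rfl fun θ _ => by rw [integral_const_mul, hf θ]

lemma integrable_linear (f : ProbabilityMeasure M.D) (a : Θ → ℝ) :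
    Integrable (fun p : M.D => ∑ θ, a θ * p.1 θ) (f : Measure M.D) :=
  integrable_finsetSum _ fun θ _ => (integrable_coord f θ).const_mul _

/-- The inequality in the first-order condition bounds the Lagrangian on all of `Δ_μ₀`. -/
lemma lagrangian_le (hV : Measurable fun p : M.D => M.V p.1 p.2)
    (f : ProbabilityMeasure M.D) (hf : f ∈ M.consistent) {Λ : FiniteMeasure M.Tcirc}
    {γ : M.Tcirc → Θ → ℝ} {a : Θ → ℝ}
    (hγ : ∀ θ, Integrable (fun t => γ t θ) (Λ : Measure M.Tcirc))
    (hle : ∀ᵐ t ∂(Λ : Measure M.Tcirc), ∀ y : Θ → ℝ, (∀ θ, 0 ≤ y θ) →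
      ∑ θ, γ t θ * y θ ≤ M.U y t)
    (ha : ∀ p : M.D, M.deriv Λ γ p ≤ ∑ θ, a θ * p.1 θ) :
    M.lagrangian f Λ ≤ ∑ θ, a θ * M.prior θ := by
  rw [← integral_linear f hf]
  exact (lagrangian_le_integral_deriv hV f hγ hle).trans
    (integral_mono (integrable_deriv hV f hγ) (integrable_linear f a) ha)

lemma payoff_le_lagrangian {f : ProbabilityMeasure M.D} (hf : M.Obedient f)
    (Λ : FiniteMeasure M.Tcirc) : M.payoff f ≤ M.lagrangian f Λ :=
  le_add_of_nonneg_right (integral_nonneg fun t => sub_nonneg.2 (hf t t.2))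

lemma contBelief_nonneg (f : ProbabilityMeasure M.D) (t : M.T) (θ : Θ) :
    0 ≤ M.contBelief f t θ :=
  mul_nonneg (inv_nonneg.2 measureReal_nonneg) (pooled_nonneg f t θ)

lemma pooled_eq_smul_contBelief (f : ProbabilityMeasure M.D) (t : M.T) :
    M.pooled f t = (f : Measure M.D).real (M.after t) • M.contBelief f t := by
  by_cases h : (f : Measure M.D).real (M.after t) = 0
  · ext θ
    have h0 : (f : Measure M.D) (M.after t) = 0 := by
      rwa [Measure.real, ENNReal.toReal_eq_zero_iff, or_iff_left (measure_ne_top _ _)] at h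
    simp [h, pooled, Measure.restrict_eq_zero.2 h0]
  · rw [contBelief, smul_inv_smul₀ h]

lemma sum_mul_pooled_eq_of_isSubgradient {f : ProbabilityMeasure M.D} {t : M.T} {γ : Θ → ℝ}
    (h : M.IsSubgradient t (M.contBelief f t) γ) :
    ∑ θ, γ θ * M.pooled f t θ = M.U (M.pooled f t) t := by
  rw [pooled_eq_smul_contBelief, U_smul measureReal_nonneg,
    ← ((isSubgradient_iff (contBelief_nonneg f t)).1 h).1, Finset.mul_sum]
  exact Finset.sum_congr rfl fun θ _ => by simp only [Pi.smul_apply, smul_eq_mul]; ring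

/-- A linear form below `U(·, t)` that agrees with it at the pooled mass is a subgradient at the
continuation belief. If `τ > t` has probability zero, both vectors are zero. -/
lemma isSubgradient_contBelief {f : ProbabilityMeasure M.D} {t : M.T} {γ : Θ → ℝ}
    (hle : ∀ y : Θ → ℝ, (∀ θ, 0 ≤ y θ) → ∑ θ, γ θ * y θ ≤ M.U y t)
    (heq : ∑ θ, γ θ * M.pooled f t θ = M.U (M.pooled f t) t) :
    M.IsSubgradient t (M.contBelief f t) γ := by
  refine (isSubgradient_iff (contBelief_nonneg f t)).2 ⟨?_, hle⟩
  rw [contBelief, U_smul (inv_nonneg.2 measureReal_nonneg), ← heq, Finset.mul_sum]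
  exact Finset.sum_congr rfl fun θ _ => by simp only [Pi.smul_apply, smul_eq_mul]; ring

/-- Sufficiency of the first-order condition: it makes `f` a maximizer of `ℒ(·, Λ)` on `Δ_μ₀`. -/
theorem solves_of_FOC (hV : Measurable fun p : M.D => M.V p.1 p.2)
    {f : ProbabilityMeasure M.D} (hf : f ∈ M.consistent) (hob : M.Obedient f)
    {Λ : FiniteMeasure M.Tcirc} {γ : M.Tcirc → Θ → ℝ} {a : Θ → ℝ}
    (hγ : M.IsSelection f Λ γ) (hfoc : M.FOC f Λ γ a) (hcs : M.lagrangian f Λ = M.payoff f) :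
    M.Solves f := by
  refine ⟨hf, hob, fun f' hf' hob' => (payoff_le_lagrangian hob' Λ).trans ?_⟩
  refine (lagrangian_le hV f' hf' hγ.2 (Filter.Eventually.of_forall fun t =>
    ((isSubgradient_iff (contBelief_nonneg f t)).1 (hγ.1 t)).2) hfoc.1).trans_eq ?_
  rw [← hcs, lagrangian_eq, ← integral_linear f hf, ← integral_congr_ae hfoc.2,
    integral_deriv hV f hγ.2]
  simp only [sum_mul_pooled_eq_of_isSubgradient (hγ.1 _)]

/-! ### From multipliers to the conclusions of the necessity part -/

/-- The distribution function `t ↦ ∫_{τ < t} g dΛ` is continuous at the times that `Λ` does not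
charge. -/
lemma continuousAt_integral_before {Λ : FiniteMeasure M.Tcirc} {g : M.Tcirc → ℝ}
    (hg : Integrable g (Λ : Measure M.Tcirc)) {t : M.T}
    (ht : (Λ : Measure M.Tcirc) {τ : M.Tcirc | (τ : M.T) = t} = 0) :
    ContinuousAt (fun s => ∫ τ in M.before s, g τ ∂(Λ : Measure M.Tcirc)) t := by
  simp only [← integral_indicator (measurableSet_before _)]
  refine continuousAt_of_dominated (bound := fun τ => |g τ|)
    (Filter.Eventually.of_forall fun s =>
      hg.aestronglyMeasurable.indicator (measurableSet_before s))
    (Filter.Eventually.of_forall fun s => Filter.Eventually.of_forall fun τ =>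
      norm_indicator_le_norm_self _ _) hg.abs ?_
  have h : ∀ᵐ τ : M.Tcirc ∂(Λ : Measure M.Tcirc), (τ : M.T) ≠ t := by
    rw [ae_iff]
    simpa using ht
  filter_upwards [h] with τ hτ
  refine (continuousAt_const (y := (M.before t).indicator g τ)).congr ?_
  rcases lt_or_gt_of_ne hτ with h | h
  · filter_upwards [isOpen_Ioi.mem_nhds h] with s hs
    rw [indicator_of_mem (show τ ∈ M.before t from h),
      indicator_of_mem (show τ ∈ M.before s from hs)]
  · filter_upwards [isOpen_Iio.mem_nhds h] with s hs
    rw [indicator_of_notMem (show τ ∉ M.before t from not_lt_of_gt h),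
      indicator_of_notMem (show τ ∉ M.before s from not_lt_of_gt (mem_Iio.1 hs))]

/-- On the support of `f` the equality in the first-order condition extends by upper
semicontinuity from almost every point to every point at which `l` is upper semicontinuous. -/
lemma deriv_eq_of_mem_support (hcont : M.Continuity) {f : ProbabilityMeasure M.D}
    {Λ : FiniteMeasure M.Tcirc} {γ : M.Tcirc → Θ → ℝ} {a : Θ → ℝ}
    (hγ : ∀ θ, Integrable (fun t => γ t θ) (Λ : Measure M.Tcirc)) (hfoc : M.FOC f Λ γ a)
    {p : M.D} (hp : p ∈ (f : Measure M.D).support)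
    (ht : M.T.Finite ∨ (Λ : Measure M.Tcirc) {τ : M.Tcirc | (τ : M.T) = p.2} = 0) :
    M.deriv Λ γ p = ∑ θ, a θ * p.1 θ := by
  refine (hfoc.1 p).antisymm (not_lt.1 fun hlt => ?_)
  have hcF : ∀ g : M.Tcirc → ℝ, Integrable g (Λ : Measure M.Tcirc) →
      ContinuousAt (fun s => ∫ τ in M.before s, g τ ∂(Λ : Measure M.Tcirc)) p.2 := fun g hg => by
    rcases ht with hfin | h0
    · have : Finite M.T := hfin
      exact continuous_of_discreteTopology.continuousAt
    · exact continuousAt_integral_before hg h0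
  have h1 : ContinuousAt (fun q : M.D => (Λ : Measure M.Tcirc).real (M.before q.2)) p := by
    have := hcF (fun _ => 1) (integrable_const 1)
    simp only [integral_const, smul_eq_mul, mul_one, measureReal_restrict_apply_univ] at this
    exact ContinuousAt.comp (g := fun s => (Λ : Measure M.Tcirc).real (M.before s)) this
      continuousAt_snd
  have h2 : ∀ θ, ContinuousAt (fun q : M.D =>
      ∫ τ in M.before q.2, γ τ θ ∂(Λ : Measure M.Tcirc)) p := fun θ =>
    ContinuousAt.comp (g := fun s => ∫ τ in M.before s, γ τ θ ∂(Λ : Measure M.Tcirc))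
      (hcF _ (hγ θ)) continuousAt_snd
  have h3 : ∀ θ, Continuous fun q : M.D => q.1 θ := fun θ =>
    (continuous_apply θ).comp (continuous_subtype_val.comp continuous_fst)
  let h : M.D → ℝ := fun q => ∑ θ, a θ * q.1 θ -
    (Λ : Measure M.Tcirc).real (M.before q.2) * M.U q.1 q.2 +
    ∑ θ, (∫ τ in M.before q.2, γ τ θ ∂(Λ : Measure M.Tcirc)) * q.1 θ
  have hh : ContinuousAt h p := by
    refine ContinuousAt.add (ContinuousAt.sub ?_ (h1.mul hcont.1.continuousAt)) ?_
    · exact tendsto_finsetSum _ fun θ _ => ((h3 θ).continuousAt (x := p)).const_mul (a θ)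
    · exact tendsto_finsetSum _ fun θ _ => (h2 θ).mul (h3 θ).continuousAt
  have hlt' : M.V p.1 p.2 < h p := by
    simp only [deriv] at hlt
    simp only [h]
    linarith
  obtain ⟨c, hc1, hc2⟩ := exists_between hlt'
  have hev : ∀ᶠ q in nhds p, M.deriv Λ γ q < ∑ θ, a θ * q.1 θ := by
    filter_upwards [hcont.2.1 p c hc1, hh.eventually (lt_mem_nhds hc2)] with q hq1 hq2
    have : M.V q.1 q.2 < h q := lt_trans hq1 hq2
    simp only [h] at this
    simp only [deriv]
    linarith
  have hnull : (f : Measure M.D) {q | M.deriv Λ γ q < ∑ θ, a θ * q.1 θ} = 0 := by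
    refine measure_mono_null (fun q hq => ?_) (ae_iff.1 hfoc.2)
    exact ne_of_lt hq
  rw [Measure.mem_support_iff_forall] at hp
  exact (hp _ hev).ne' hnull

/-- A multiplier and linear forms `γ_t ≤ U(·, t)` for which `l ≤ a · μ` with
`a · μ₀ ≤ 𝔼_f[V]` certify everything: the chain
`𝔼_f[V] ≤ ℒ(f, Λ) ≤ ∫ l df ≤ a · μ₀ ≤ 𝔼_f[V]` collapses, and its links are complementary slackness,
the subgradient property and the equality in the first-order condition. -/
theorem conclusion_of_multipliers (hcont : M.Continuity) {f : ProbabilityMeasure M.D}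
    (hf : f ∈ M.consistent) (hob : M.Obedient f) {Λ : FiniteMeasure M.Tcirc}
    {γ : M.Tcirc → Θ → ℝ} {a : Θ → ℝ}
    (hγ : ∀ θ, Integrable (fun t => γ t θ) (Λ : Measure M.Tcirc))
    (hle : ∀ᵐ t ∂(Λ : Measure M.Tcirc), ∀ y : Θ → ℝ, (∀ θ, 0 ≤ y θ) →
      ∑ θ, γ t θ * y θ ≤ M.U y t)
    (ha : ∀ p : M.D, M.deriv Λ γ p ≤ ∑ θ, a θ * p.1 θ)
    (hR : ∑ θ, a θ * M.prior θ ≤ M.payoff f) :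
    ∃ (Λ : FiniteMeasure M.Tcirc) (γ : M.Tcirc → Θ → ℝ) (a : Θ → ℝ),
      M.SolvesDual Λ ∧ M.lagrangian f Λ = M.payoff f ∧
      M.IsSelection f Λ γ ∧ M.FOC f Λ γ a ∧
      (∀ p ∈ (f : Measure M.D).support,
        M.T.Finite ∨ (Λ : Measure M.Tcirc) {τ | (τ : M.T) = p.2} = 0 →
        M.deriv Λ γ p = ∑ θ, a θ * p.1 θ) := by
  have hV : Measurable fun p : M.D => M.V p.1 p.2 := hcont.2.1.measurable
  have h1 := payoff_le_lagrangian hob Λ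
  have h2 := lagrangian_le_integral_deriv hV f hγ hle
  have h3 : ∫ p, M.deriv Λ γ p ∂(f : Measure M.D) ≤ ∑ θ, a θ * M.prior θ := by
    rw [← integral_linear f hf]
    exact integral_mono (integrable_deriv hV f hγ) (integrable_linear f a) ha
  have hcs : M.lagrangian f Λ = M.payoff f := le_antisymm (by linarith) h1
  have heq : ∀ᵐ p ∂(f : Measure M.D), M.deriv Λ γ p = ∑ θ, a θ * p.1 θ := by
    refine (integral_eq_iff_of_ae_le (integrable_deriv hV f hγ) (integrable_linear f a)
      (Filter.Eventually.of_forall ha)).1 ?_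
    rw [integral_linear f hf]
    linarith
  have hpool : ∀ᵐ t ∂(Λ : Measure M.Tcirc),
      ∑ θ, γ t θ * M.pooled f t θ = M.U (M.pooled f t) t := by
    refine (integral_eq_iff_of_ae_le (integrable_subgradient_pooled f hγ)
      (integrable_U_pooled f Λ) ?_).1 ?_
    · filter_upwards [hle] with t ht using ht _ (pooled_nonneg f t)
    · have h4 : M.lagrangian f Λ = ∫ p, M.deriv Λ γ p ∂(f : Measure M.D) := by linarith
      rw [lagrangian_eq, integral_deriv hV f hγ,
        integral_sub (integrable_gain f Λ) (integrable_U_pooled f Λ),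
        integral_sub (integrable_gain f Λ) (integrable_subgradient_pooled f hγ)] at h4
      linarith
  -- On the null set where `γ_t` is not a subgradient, it is replaced by any subgradient.
  choose γ₀ hγ₀ using fun t : M.Tcirc => exists_isSubgradient (contBelief_nonneg f t) (t : M.T)
  classical
  let γ' : M.Tcirc → Θ → ℝ := fun t =>
    if M.IsSubgradient t (M.contBelief f t) (γ t) then γ t else γ₀ t
  have hγγ' : ∀ᵐ t ∂(Λ : Measure M.Tcirc), γ t = γ' t := by
    filter_upwards [hle, hpool] with t ht1 ht2
    exact (if_pos (isSubgradient_contBelief ht1 ht2)).symm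
  have hderiv : M.deriv Λ γ = M.deriv Λ γ' := by
    ext p
    simp only [deriv]
    congr 1
    refine Finset.sum_congr rfl fun θ _ => ?_
    congr 1
    refine integral_congr_ae (ae_restrict_of_ae ?_)
    filter_upwards [hγγ'] with t ht
    rw [ht]
  have hγ' : ∀ θ, Integrable (fun t => γ' t θ) (Λ : Measure M.Tcirc) := fun θ =>
    (hγ θ).congr (by filter_upwards [hγγ'] with t ht; rw [ht])
  have hsel : M.IsSelection f Λ γ' := by
    refine ⟨fun t => ?_, hγ'⟩
    by_cases h : M.IsSubgradient t (M.contBelief f t) (γ t)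
    · simpa only [γ', if_pos h] using h
    · simpa only [γ', if_neg h] using hγ₀ t
  have hfoc : M.FOC f Λ γ' a := by
    rw [FOC, ← hderiv]
    exact ⟨ha, heq⟩
  have hub : ∀ f' ∈ M.consistent, M.lagrangian f' Λ ≤ M.payoff f := fun f' hf' =>
    (lagrangian_le hV f' hf' hγ hle ha).trans hR
  have hdual : M.dualValue Λ = (M.payoff f : EReal) := by
    refine le_antisymm (iSup₂_le fun f' hf' => EReal.coe_le_coe_iff.2 (hub f' hf')) ?_
    rw [← hcs]
    exact le_iSup₂ (f := fun f' (_ : f' ∈ M.consistent) => (M.lagrangian f' Λ : EReal)) f hf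
  have hlow : ∀ Λ' : FiniteMeasure M.Tcirc, (M.payoff f : EReal) ≤ M.lagrangian f Λ' := fun Λ' =>
    EReal.coe_le_coe_iff.2 (payoff_le_lagrangian hob Λ')
  refine ⟨Λ, γ', a, ⟨fun Λ' => ?_, ?_⟩, hcs, hsel, hfoc, fun p hp ht =>
    deriv_eq_of_mem_support hcont hγ' hfoc hp ht⟩
  · rw [hdual]
    exact (hlow Λ').trans
      (le_iSup₂ (f := fun f' (_ : f' ∈ M.consistent) => (M.lagrangian f' Λ' : EReal)) f hf)
  · rw [hdual]
    refine le_antisymm ((le_iInf hlow).trans (le_iSup₂ (f := fun f' (_ : f' ∈ M.consistent) =>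
      ⨅ Λ' : FiniteMeasure M.Tcirc, (M.lagrangian f' Λ' : EReal)) f hf)) ?_
    exact iSup₂_le fun f' hf' => (iInf_le _ Λ).trans (EReal.coe_le_coe_iff.2 (hub f' hf'))

/-! ### Multipliers from the M. Riesz extension theorem -/

/-- The bounded real functions on `ι`, without any regularity. -/
def boundedFn (ι : Type*) : Submodule ℝ (ι → ℝ) where
  carrier := {z | ∃ C : ℝ, ∀ i, |z i| ≤ C}
  add_mem' := by
    rintro z z' ⟨C, hC⟩ ⟨C', hC'⟩
    exact ⟨C + C', fun i => (abs_add_le _ _).trans (add_le_add (hC i) (hC' i))⟩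
  zero_mem' := ⟨0, fun i => by simp⟩
  smul_mem' := by
    rintro c z ⟨C, hC⟩
    refine ⟨|c| * C, fun i => ?_⟩
    rw [Pi.smul_apply, smul_eq_mul, abs_mul]
    exact mul_le_mul_of_nonneg_left (hC i) (abs_nonneg c)

/-- The indicator function of a set, as a bounded function. -/
def ind {ι : Type*} (S : Set ι) : boundedFn ι :=
  ⟨S.indicator 1, 1, fun i => by
    by_cases h : i ∈ S <;> simp [h]⟩

lemma ind_apply {ι : Type*} (S : Set ι) (i : ι) : (ind S : ι → ℝ) i = S.indicator 1 i := rfl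

lemma ind_of_mem {ι : Type*} {S : Set ι} {i : ι} (h : i ∈ S) : (ind S : ι → ℝ) i = 1 := by
  simp [ind_apply, h]

lemma ind_of_notMem {ι : Type*} {S : Set ι} {i : ι} (h : i ∉ S) : (ind S : ι → ℝ) i = 0 := by
  simp [ind_apply, h]

/-- The integral of `h` against the finitely supported signed measure with weights `w`. -/
abbrev wsum {α : Type*} (h : α → ℝ) : (α →₀ ℝ) →ₗ[ℝ] ℝ := Finsupp.linearCombination ℝ h

lemma wsum_eq {α : Type*} (h : α → ℝ) (w : α →₀ ℝ) : wsum h w = ∑ p ∈ w.support, w p * h p := by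
  simp [wsum, Finsupp.linearCombination_apply, Finsupp.sum]

lemma wsum_nonneg {α : Type*} {h : α → ℝ} {w : α →₀ ℝ} (hw : ∀ p, 0 ≤ w p) (hh : ∀ p, 0 ≤ h p) :
    0 ≤ wsum h w := by
  rw [wsum_eq]
  exact Finset.sum_nonneg fun p _ => mul_nonneg (hw p) (hh p)

lemma abs_wsum_le {α : Type*} {h : α → ℝ} {w : α →₀ ℝ} (hw : ∀ p, 0 ≤ w p) {C : ℝ}
    (hh : ∀ p, |h p| ≤ C) : |wsum h w| ≤ C * wsum (fun _ => 1) w := by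
  rw [wsum_eq, wsum_eq, Finset.mul_sum]
  refine (Finset.abs_sum_le_sum_abs _ _).trans (Finset.sum_le_sum fun p _ => ?_)
  rw [abs_mul, abs_of_nonneg (hw p), mul_one, mul_comm]
  exact mul_le_mul_of_nonneg_right (hh p) (hw p)

/-- The mass vector `∫_{τ > t} μ dw` of a finitely supported measure. -/
def wpooled (w : M.D →₀ ℝ) (t : M.T) : Θ → ℝ :=
  fun θ => wsum ((M.after t).indicator fun p => p.1 θ) w

/-- The agent's payoff `∫_{τ > t} U dw` under a finitely supported measure. -/
def wgain (w : M.D →₀ ℝ) (t : M.T) : ℝ :=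
  wsum ((M.after t).indicator fun p => M.U p.1 p.2) w

lemma wpooled_add (w w' : M.D →₀ ℝ) (t : M.T) :
    wpooled (w + w') t = wpooled w t + wpooled w' t := by
  ext θ
  simp [wpooled]

lemma wpooled_smul (c : ℝ) (w : M.D →₀ ℝ) (t : M.T) : wpooled (c • w) t = c • wpooled w t := by
  ext θ
  simp [wpooled]

/-- The convex cone of the values `(r, x, z, y)` that finitely supported positive measures `w`
attain in the perturbed problem: `w` has payoff at least `r` and mean vector `x`, and it satisfies
the obedience constraint at every `t` with slack `z t` when the pooled mass in that constraint is
shifted by `y t`. Perturbing the argument of `U(·, t)` is what produces subgradients as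
multipliers. -/
def attainable (M : Model Θ A) :
    PointedCone ℝ (ℝ × (Θ → ℝ) × boundedFn M.Tcirc × (Θ → boundedFn M.Tcirc)) where
  carrier := {e | ∃ w : M.D →₀ ℝ, (∀ p, 0 ≤ w p) ∧ e.1 ≤ wsum (fun p => M.V p.1 p.2) w ∧
    (∀ θ, e.2.1 θ = wsum (fun p => p.1 θ) w) ∧
    ∀ t : M.Tcirc, e.2.2.1.1 t ≤
      wgain w t - M.U (wpooled w t + fun θ => (e.2.2.2 θ).1 t) t}
  add_mem' := by
    rintro e e' ⟨w, h1, h2, h3, h4⟩ ⟨w', h1', h2', h3', h4'⟩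
    refine ⟨w + w', fun p => add_nonneg (h1 p) (h1' p), ?_, fun θ => ?_, fun t => ?_⟩
    · rw [map_add]
      exact add_le_add h2 h2'
    · rw [map_add, ← h3, ← h3']
      rfl
    · have h5 := U_add_le (M := M) (wpooled w t + fun θ => (e.2.2.2 θ).1 t)
        (wpooled w' t + fun θ => (e'.2.2.2 θ).1 t) t
      have h6 : (wpooled w t + fun θ => (e.2.2.2 θ).1 t) +
          (wpooled w' t + fun θ => (e'.2.2.2 θ).1 t) =
          wpooled (w + w') t + fun θ => ((e + e').2.2.2 θ).1 t := by
        rw [wpooled_add]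
        ext θ
        simp only [Pi.add_apply, Prod.snd_add, Submodule.coe_add]
        ring
      have h7 : wgain (w + w') (t : M.T) = wgain w t + wgain w' t := map_add _ _ _
      have h8 : (e + e').2.2.1.1 t = e.2.2.1.1 t + e'.2.2.1.1 t := rfl
      rw [h6] at h5
      rw [h7, h8]
      linarith [h4 t, h4' t]
  zero_mem' := by
    refine ⟨0, fun p => le_rfl, by simp, fun θ => by simp, fun t => ?_⟩
    have : (wpooled (0 : M.D →₀ ℝ) t +
        fun θ => (((0 : ℝ × (Θ → ℝ) × boundedFn M.Tcirc × (Θ → boundedFn M.Tcirc)).2.2.2 θ).1 t)) =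
        (0 : Θ → ℝ) := by
      ext θ
      simp [wpooled]
    rw [this]
    simp [wgain]
  smul_mem' := by
    rintro ⟨c, hc⟩ e ⟨w, h1, h2, h3, h4⟩
    refine ⟨c • w, fun p => mul_nonneg hc (h1 p), ?_, fun θ => ?_, fun t => ?_⟩
    · rw [map_smul]
      exact mul_le_mul_of_nonneg_left h2 hc
    · rw [map_smul, ← h3]
      rfl
    · have h6 : (wpooled (c • w) t +
          fun θ => (((⟨c, hc⟩ : {c : ℝ // 0 ≤ c}) • e).2.2.2 θ).1 t) =
          c • (wpooled w t + fun θ => (e.2.2.2 θ).1 t) := by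
        rw [wpooled_smul, smul_add]
        rfl
      have h7 : wgain (c • w) (t : M.T) = c * wgain w t := map_smul _ _ _
      rw [h6, h7, U_smul hc, ← mul_sub]
      exact mul_le_mul_of_nonneg_left (h4 t) hc

lemma mem_attainable {r : ℝ} {x : Θ → ℝ} {z : boundedFn M.Tcirc} {y : Θ → boundedFn M.Tcirc} :
    (r, x, z, y) ∈ M.attainable ↔ ∃ w : M.D →₀ ℝ, (∀ p, 0 ≤ w p) ∧
      r ≤ wsum (fun p => M.V p.1 p.2) w ∧ (∀ θ, x θ = wsum (fun p => p.1 θ) w) ∧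
      ∀ t : M.Tcirc, z.1 t ≤ wgain w t - M.U (wpooled w t + fun θ => (y θ).1 t) t := Iff.rfl

lemma attainable_mono {r r' : ℝ} {x : Θ → ℝ} {z z' : boundedFn M.Tcirc}
    {y : Θ → boundedFn M.Tcirc} (h : (r, x, z, y) ∈ M.attainable) (hr : r' ≤ r)
    (hz : ∀ t, z'.1 t ≤ z.1 t) : (r', x, z', y) ∈ M.attainable := by
  obtain ⟨w, h1, h2, h3, h4⟩ := h
  exact ⟨w, h1, hr.trans h2, h3, fun t => (hz t).trans (h4 t)⟩

/-- The total mass of a positive measure is the sum of the coordinates of its mean vector. -/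
lemma wsum_one (w : M.D →₀ ℝ) :
    wsum (fun _ => 1) w = ∑ θ, wsum (fun p : M.D => p.1 θ) w := by
  simp only [wsum_eq]
  rw [Finset.sum_comm]
  refine Finset.sum_congr rfl fun p _ => ?_
  rw [← Finset.mul_sum, sum_simplex]

/-- A finitely supported positive measure with total mass `c > 0`, normalized. -/
lemma exists_probabilityMeasure {w : M.D →₀ ℝ} (hw : ∀ p, 0 ≤ w p) {c : ℝ} (hc : 0 < c)
    (hsum : wsum (fun _ => 1) w = c) :
    ∃ f : ProbabilityMeasure M.D, ∀ h : M.D → ℝ, ∫ p, h p ∂(f : Measure M.D) = c⁻¹ * wsum h w := by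
  let ν : Measure M.D := ∑ p ∈ w.support, ENNReal.ofReal (c⁻¹ * w p) • Measure.dirac p
  have hpos : ∀ p, 0 ≤ c⁻¹ * w p := fun p => mul_nonneg (inv_nonneg.2 hc.le) (hw p)
  have hν : IsProbabilityMeasure ν := by
    constructor
    simp only [ν, Measure.coe_finsetSum, Finset.sum_apply, Measure.smul_apply, measure_univ,
      smul_eq_mul, mul_one]
    rw [← ENNReal.ofReal_sum_of_nonneg fun p _ => hpos p, ← Finset.mul_sum]
    rw [wsum_eq] at hsum
    simp only [mul_one] at hsum
    rw [hsum, inv_mul_cancel₀ hc.ne', ENNReal.ofReal_one]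
  refine ⟨⟨ν, hν⟩, fun h => ?_⟩
  change ∫ p, h p ∂ν = _
  rw [integral_finsetSum_measure fun p _ =>
    (integrable_dirac (by simp)).smul_measure ENNReal.ofReal_ne_top, wsum_eq, Finset.mul_sum]
  refine Finset.sum_congr rfl fun p _ => ?_
  rw [integral_smul_measure, integral_dirac, ENNReal.toReal_ofReal (hpos p), smul_eq_mul, mul_assoc]

/-- Optimality of `f` bounds the unperturbed attainable payoffs. -/
lemma le_of_mem_attainable {f : ProbabilityMeasure M.D} (hf : M.Solves f) {r c : ℝ}
    (h : (r, c • (M.prior : Θ → ℝ), (0 : boundedFn M.Tcirc), (0 : Θ → boundedFn M.Tcirc)) ∈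
      M.attainable) : r ≤ c * M.payoff f := by
  obtain ⟨w, hw, hr, hx, hz⟩ := mem_attainable.1 h
  have hsum : wsum (fun _ => 1) w = c := by
    rw [wsum_one, ← Finset.sum_congr rfl fun θ _ => hx θ]
    simp only [Pi.smul_apply, smul_eq_mul]
    rw [← Finset.mul_sum, sum_simplex, mul_one]
  have hc : 0 ≤ c := hsum ▸ wsum_nonneg hw fun _ => zero_le_one
  rcases hc.eq_or_lt with rfl | hc
  · have := (le_abs_self _).trans (abs_wsum_le hw fun p : M.D => abs_V_le p.1 p.2)
    rw [hsum, mul_zero] at this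
    rw [zero_mul]
    exact hr.trans this
  obtain ⟨f', hf'⟩ := exists_probabilityMeasure hw hc hsum
  have hpool : ∀ t, M.pooled f' t = c⁻¹ • wpooled w t := fun t => by
    ext θ
    rw [pooled, ← integral_indicator (measurableSet_after _), hf']
    rfl
  have hmem : f' ∈ M.consistent := fun θ => by
    rw [hf', ← hx, Pi.smul_apply, smul_eq_mul, inv_mul_cancel_left₀ hc.ne']
  have hob : M.Obedient f' := fun t ht => by
    rw [Uext_eq_U (pooled_nonneg f' t), hpool, U_smul (inv_nonneg.2 hc.le),
      ← integral_indicator (measurableSet_after _), hf']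
    refine mul_le_mul_of_nonneg_left ?_ (inv_nonneg.2 hc.le)
    have h0 := hz ⟨t, ht⟩
    have e : (fun θ => ((0 : Θ → boundedFn M.Tcirc) θ).1 ⟨t, ht⟩) = (0 : Θ → ℝ) := rfl
    rw [e, add_zero] at h0
    exact sub_nonneg.1 h0
  have hle := hf.2.2 f' hmem hob
  rw [payoff, hf'] at hle
  rw [inv_mul_le_iff₀ hc] at hle
  exact hr.trans hle

/-- Multipliers in finitely additive form: `lam` is the multiplier of the obedience constraints,
`Γ` that of the perturbations of the pooled mass, and `a` that of the consistency constraint. The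
values of `lam` and `Γ θ` at `1_{t < τ}` stand for `Λ({t < τ})` and `∫_{t < τ} γ_t(θ) dΛ`, and the
last field is the inequality in the first-order condition with these values. -/
structure IsMultiplier (M : Model Θ A) (a : Θ → ℝ) (lam : boundedFn M.Tcirc →ₗ[ℝ] ℝ)
    (Γ : Θ → boundedFn M.Tcirc →ₗ[ℝ] ℝ) : Prop where
  nonneg : ∀ z : boundedFn M.Tcirc, (∀ t, 0 ≤ z.1 t) → 0 ≤ lam z
  sum_le : ∀ (y : Θ → boundedFn M.Tcirc) (z : boundedFn M.Tcirc),
    (∀ t : M.Tcirc, M.U (fun θ => (y θ).1 t) t ≤ z.1 t) → ∑ θ, Γ θ (y θ) ≤ lam z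
  foc : ∀ p : M.D, M.V p.1 p.2 + lam (ind (M.before p.2)) * M.U p.1 p.2 -
    ∑ θ, Γ θ (ind (M.before p.2)) * p.1 θ ≤ ∑ θ, a θ * p.1 θ

/-- Slater's condition: a finitely supported positive measure whose mean vector is a multiple of
the prior satisfies the obedience constraints with uniform slack. -/
def Slater (M : Model Θ A) : Prop :=
  ∃ (r c η : ℝ) (z : boundedFn M.Tcirc), 0 < η ∧ (∀ t, η ≤ z.1 t) ∧
    (r, c • (M.prior : Θ → ℝ), z, (0 : Θ → boundedFn M.Tcirc)) ∈ M.attainable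

/-- The multipliers come from extending the functional `(r, c μ₀, 0, 0) ↦ c 𝔼_f[V] - r`, which
is nonnegative on the cone of attainable values by optimality of `f`, to a functional which is
nonnegative on the whole cone. -/
theorem exists_isMultiplier (hfull : ∀ θ, 0 < M.prior θ) (hslater : M.Slater)
    {f : ProbabilityMeasure M.D} (hf : M.Solves f) :
    ∃ (a : Θ → ℝ) (lam : boundedFn M.Tcirc →ₗ[ℝ] ℝ) (Γ : Θ → boundedFn M.Tcirc →ₗ[ℝ] ℝ),
      M.IsMultiplier a lam Γ ∧ ∑ θ, a θ * M.prior θ = M.payoff f := by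
  classical
  let F := ℝ × (Θ → ℝ) × boundedFn M.Tcirc × (Θ → boundedFn M.Tcirc)
  let φ : F →ₗ[ℝ] ℝ :=
    { toFun := fun e => M.payoff f * (∑ θ, e.2.1 θ) - e.1
      map_add' := fun e e' => by
        change M.payoff f * (∑ θ, (e.2.1 θ + e'.2.1 θ)) - (e.1 + e'.1) = _
        rw [Finset.sum_add_distrib]
        ring
      map_smul' := fun c e => by
        change M.payoff f * (∑ θ, c * e.2.1 θ) - c * e.1 = c * (M.payoff f * (∑ θ, e.2.1 θ) - e.1)
        rw [← Finset.mul_sum]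
        ring }
  let L : ℝ × ℝ →ₗ[ℝ] F :=
    { toFun := fun q => (q.1, q.2 • (M.prior : Θ → ℝ), 0, 0)
      map_add' := fun q q' => Prod.ext rfl (Prod.ext (add_smul _ _ _)
        (Prod.ext (add_zero 0).symm (add_zero 0).symm))
      map_smul' := fun c q => Prod.ext rfl (Prod.ext (mul_smul _ _ _)
        (Prod.ext (smul_zero c).symm (smul_zero c).symm)) }
  have hφL : ∀ r c, φ (L (r, c)) = c * M.payoff f - r := fun r c => by
    change M.payoff f * (∑ θ, c * M.prior θ) - r = _
    rw [← Finset.mul_sum, sum_simplex]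
    ring
  obtain ⟨g, hg1, hg2⟩ := riesz_extension M.attainable (φ.toPMap (LinearMap.range L)) (by
    rintro ⟨_, ⟨r, c⟩, rfl⟩ hmem
    change 0 ≤ φ (L (r, c))
    rw [hφL]
    exact sub_nonneg.2 (le_of_mem_attainable hf hmem)) (by
    rintro ⟨r, x, z, y⟩
    obtain ⟨r₁, c₁, η, z₁, hη, hz₁, h1⟩ := hslater
    -- A measure with full revelation at one date absorbs the perturbation of the mean vector.
    obtain ⟨n, hn⟩ : ∃ n : ℝ, ∀ θ, 0 ≤ x θ + n * M.prior θ := by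
      refine ⟨∑ θ, |x θ| / M.prior θ, fun θ => ?_⟩
      have h2 : |x θ| / M.prior θ ≤ ∑ θ, |x θ| / M.prior θ :=
        Finset.single_le_sum (f := fun θ => |x θ| / M.prior θ)
          (fun θ _ => div_nonneg (abs_nonneg _) (hfull θ).le) (Finset.mem_univ θ)
      rw [div_le_iff₀ (hfull θ)] at h2
      linarith [neg_abs_le (x θ)]
    obtain ⟨s, hs⟩ := M.nonempty_T
    let δ : Θ → M.D := fun θ => (⟨Pi.single θ 1, single_mem_stdSimplex ℝ θ⟩, ⟨s, hs⟩)
    let w : M.D →₀ ℝ := ∑ θ, Finsupp.single (δ θ) (x θ + n * M.prior θ)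
    have hw : ∀ p, 0 ≤ w p := fun p => by
      simp only [w, Finsupp.coe_finsetSum, Finset.sum_apply]
      refine Finset.sum_nonneg fun θ _ => ?_
      rw [Finsupp.single_apply]
      split_ifs
      exacts [hn θ, le_rfl]
    have hwx : ∀ θ, x θ + n * M.prior θ = wsum (fun p : M.D => p.1 θ) w := fun θ => by
      simp only [w, map_sum, wsum, Finsupp.linearCombination_single, smul_eq_mul]
      rw [Finset.sum_eq_single θ]
      · change _ = _ * (Pi.single θ 1 : Θ → ℝ) θ
        simp
      · intro θ' _ hne
        change _ * (Pi.single θ' 1 : Θ → ℝ) θ = 0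
        simp [hne.symm]
      · simp
    obtain ⟨Cz, hCz⟩ := z.2
    choose Cy hCy using fun θ => (y θ).2
    let m := wsum (fun _ => 1) w
    have hpool : ∀ t θ, |wpooled w t θ| ≤ m := fun t θ => by
      have := abs_wsum_le (h := (M.after t).indicator fun p : M.D => p.1 θ) hw (C := 1) fun p => by
        by_cases hp : p ∈ M.after t
        · simpa [hp] using abs_coord_le p.1 θ
        · simp [hp]
      rwa [one_mul] at this
    let C := M.bd * m + M.bd * ∑ θ, (m + Cy θ)
    have hC : ∀ t : M.Tcirc,
        -C ≤ wgain w t - M.U (wpooled w t + fun θ => (y θ).1 t) t := fun t => by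
      have h3 : |wgain w (t : M.T)| ≤ M.bd * m := abs_wsum_le hw fun p => by
        by_cases hp : p ∈ M.after t
        · simpa [hp] using abs_U_simplex_le p.1 p.2
        · simpa [hp] using M.bd_nonneg
      have h4 : M.U (wpooled w t + fun θ => (y θ).1 t) t ≤ M.bd * ∑ θ, (m + Cy θ) :=
        ((le_abs_self _).trans (abs_U_le _ _)).trans (mul_le_mul_of_nonneg_left
          (Finset.sum_le_sum fun θ _ => (abs_add_le _ _).trans (add_le_add (hpool t θ) (hCy θ t)))
          M.bd_nonneg)
      have := neg_abs_le (wgain w (t : M.T))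
      simp only [C]
      linarith
    have h2 : (wsum (fun p => M.V p.1 p.2) w, x + n • (M.prior : Θ → ℝ),
        (-C) • (ind univ : boundedFn M.Tcirc), y) ∈ M.attainable :=
      mem_attainable.2 ⟨w, hw, le_rfl, hwx, fun t => by
        refine le_trans (le_of_eq ?_) (hC t)
        change -C * (ind univ : boundedFn M.Tcirc).1 t = -C
        rw [ind_of_mem (mem_univ t), mul_one]⟩
    obtain ⟨k, hk⟩ := exists_nat_ge ((C + Cz) / η)
    rw [div_le_iff₀ hη] at hk
    have h3 := M.attainable.add_mem
      (PointedCone.smul_mem M.attainable (k.cast_nonneg (α := ℝ)) h1) h2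
    refine ⟨⟨L (k * r₁ + wsum (fun p => M.V p.1 p.2) w - r, k * c₁ + n), _, rfl⟩, ?_⟩
    have h4 := attainable_mono (r' := k * r₁ + wsum (fun p => M.V p.1 p.2) w) (z' := z) h3
      le_rfl (fun t => ?_)
    · convert h4 using 1
      refine Prod.ext ?_ (Prod.ext ?_ (Prod.ext ?_ ?_))
      · change k * r₁ + wsum (fun p => M.V p.1 p.2) w - r + r = _
        ring
      · ext θ
        change (k * c₁ + n) * M.prior θ + x θ = k * (c₁ * M.prior θ) + (x θ + n * M.prior θ)
        ring
      · exact zero_add z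
      · change 0 + y = (k : ℝ) • 0 + y
        rw [smul_zero]
    · change z.1 t ≤ k * z₁.1 t + -C * (ind univ : boundedFn M.Tcirc).1 t
      rw [ind_of_mem (mem_univ t)]
      have := mul_le_mul_of_nonneg_left (hz₁ t) (k.cast_nonneg (α := ℝ))
      linarith [(le_abs_self _).trans (hCz t)])
  have hgL : ∀ r c, g (L (r, c)) = c * M.payoff f - r := fun r c => by
    rw [← hφL]
    exact hg1 ⟨L (r, c), _, rfl⟩
  let α : (Θ → ℝ) →ₗ[ℝ] ℝ := g ∘ₗ LinearMap.inr ℝ ℝ _ ∘ₗ LinearMap.inl ℝ _ _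
  let lam : boundedFn M.Tcirc →ₗ[ℝ] ℝ :=
    -(g ∘ₗ LinearMap.inr ℝ ℝ _ ∘ₗ LinearMap.inr ℝ _ _ ∘ₗ LinearMap.inl ℝ _ _)
  let β : (Θ → boundedFn M.Tcirc) →ₗ[ℝ] ℝ :=
    -(g ∘ₗ LinearMap.inr ℝ ℝ _ ∘ₗ LinearMap.inr ℝ _ _ ∘ₗ LinearMap.inr ℝ _ _)
  have hα : ∀ x, α x = ∑ θ, α (Pi.single θ 1) * x θ := fun x => by
    conv_lhs => rw [← Finset.univ_sum_single x, map_sum]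
    refine Finset.sum_congr rfl fun θ _ => ?_
    rw [mul_comm, ← smul_eq_mul, ← map_smul, ← Pi.single_smul, smul_eq_mul, mul_one]
  let Γ : Θ → boundedFn M.Tcirc →ₗ[ℝ] ℝ := fun θ =>
    β ∘ₗ LinearMap.single ℝ (fun _ => boundedFn M.Tcirc) θ
  have hβ : ∀ y, β y = ∑ θ, Γ θ (y θ) := fun y => by
    conv_lhs => rw [← Finset.univ_sum_single y, map_sum]
    rfl
  have hdec : ∀ r x z y, (r, x, z, y) ∈ M.attainable → r - α x + lam z + β y ≤ 0 :=
      fun r x z y h => by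
    have h0 := hg2 _ h
    have h1 : ((r, x, z, y) : F) = L (r, 0) + (0, x, 0, 0) + (0, 0, z, 0) + (0, 0, 0, y) := by
      refine Prod.ext ?_ (Prod.ext ?_ (Prod.ext ?_ ?_))
      · change r = r + 0 + 0 + 0
        simp
      · change x = (0 : ℝ) • (M.prior : Θ → ℝ) + x + 0 + 0
        simp
      · change z = 0 + 0 + z + 0
        simp
      · change y = 0 + 0 + 0 + y
        simp
    rw [h1, map_add, map_add, map_add, hgL] at h0
    change 0 ≤ 0 * M.payoff f - r + α x + g (0, 0, z, 0) + g (0, 0, 0, y) at h0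
    change r - α x + -g (0, 0, z, 0) + -g (0, 0, 0, y) ≤ 0
    linarith
  refine ⟨fun θ => α (Pi.single θ 1), lam, Γ,
    ⟨fun z hz => ?_, fun y z hyz => ?_, fun p => ?_⟩, ?_⟩
  · have := hdec 0 0 (-z) 0 (attainable_mono M.attainable.zero_mem le_rfl fun t =>
      neg_nonpos.2 (hz t))
    simp only [map_neg, map_zero] at this
    linarith
  · have := hdec 0 0 (-z) y (mem_attainable.2 ⟨0, fun _ => le_rfl, by simp, fun θ => by simp,
      fun t => by
        have e : wpooled (0 : M.D →₀ ℝ) t = 0 := by ext θ; simp [wpooled]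
        have e' : wgain (0 : M.D →₀ ℝ) (t : M.T) = 0 := map_zero _
        rw [e, e', zero_add, zero_sub]
        exact neg_le_neg (hyz t)⟩)
    simp only [map_neg, map_zero] at this
    rw [← hβ]
    linarith
  · have := hdec (M.V p.1 p.2) p.1 (M.U p.1 p.2 • ind (M.before p.2))
      (fun θ => -p.1 θ • ind (M.before p.2)) (mem_attainable.2 ⟨Finsupp.single p 1, fun q => by
          rw [Finsupp.single_apply]
          split_ifs
          exacts [zero_le_one, le_rfl], by simp, fun θ => by simp, fun t => by
        have e : wpooled (Finsupp.single p (1 : ℝ)) t +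
            (fun θ => (-p.1 θ • ind (M.before p.2) : boundedFn M.Tcirc).1 t) = 0 := by
          ext θ
          change wpooled (Finsupp.single p (1 : ℝ)) t θ +
            -p.1 θ * (ind (M.before p.2) : boundedFn M.Tcirc).1 t = 0
          by_cases h : (t : M.T) < p.2
          · rw [ind_of_mem (show t ∈ M.before p.2 from h)]
            simp [wpooled, show p ∈ M.after t from h]
          · rw [ind_of_notMem (show t ∉ M.before p.2 from h)]
            simp [wpooled, show p ∉ M.after t from h]
        rw [e, U_zero, sub_zero]
        change M.U p.1 p.2 * (ind (M.before p.2) : boundedFn M.Tcirc).1 t ≤ _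
        by_cases h : (t : M.T) < p.2
        · rw [ind_of_mem (show t ∈ M.before p.2 from h)]
          simp [wgain, show p ∈ M.after t from h]
        · rw [ind_of_notMem (show t ∉ M.before p.2 from h)]
          simp [wgain, show p ∉ M.after t from h]⟩)
    rw [hβ, hα] at this
    simp only [map_smul, smul_eq_mul, neg_mul, Finset.sum_neg_distrib] at this
    simp only [mul_comm _ (p.1 _)] at this ⊢
    rw [mul_comm (lam _)]
    linarith
  · rw [← hα]
    have := hgL 0 1
    rw [sub_zero, one_mul] at this
    rw [← this]
    change g (0, M.prior, 0, 0) = g (0, (1 : ℝ) • (M.prior : Θ → ℝ), 0, 0)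
    rw [one_smul]

namespace IsMultiplier

variable {a : Θ → ℝ} {lam : boundedFn M.Tcirc →ₗ[ℝ] ℝ} {Γ : Θ → boundedFn M.Tcirc →ₗ[ℝ] ℝ}

lemma abs_le (h : M.IsMultiplier a lam Γ) (θ : Θ) {z : boundedFn M.Tcirc} (hz : ∀ t, 0 ≤ z.1 t) :
    |Γ θ z| ≤ M.bd * lam z := by
  classical
  have key : ∀ c : ℝ, |c| = 1 → c * Γ θ z ≤ M.bd * lam z := fun c hc => by
    have h1 := h.sum_le (Pi.single θ (c • z)) (M.bd • z) fun t => by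
      refine (le_abs_self _).trans ((abs_U_le _ _).trans (le_of_eq ?_))
      change _ = M.bd * z.1 t
      rw [Finset.sum_eq_single θ]
      · rw [Pi.single_eq_same]
        change M.bd * |c * z.1 t| = _
        rw [abs_mul, hc, one_mul, abs_of_nonneg (hz t)]
      · intro θ' _ hne
        rw [Pi.single_eq_of_ne hne]
        exact abs_zero
      · simp
    rw [Finset.sum_eq_single θ, Pi.single_eq_same, map_smul, map_smul] at h1
    · exact h1
    · intro θ' _ hne
      rw [Pi.single_eq_of_ne hne, map_zero]
    · simp
  refine _root_.abs_le.2 ⟨?_, ?_⟩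
  · linarith [key (-1) (by simp)]
  · linarith [key 1 (by simp)]

/-- On a set of times the vector of the `Γ θ` is dominated by any bound on `U(x, ·)` times the mass
of the set. -/
lemma sum_ind_le (h : M.IsMultiplier a lam Γ) (x : Θ → ℝ) {S : Set M.Tcirc} {c : ℝ}
    (hc : ∀ t ∈ S, M.U x t ≤ c) : ∑ θ, Γ θ (ind S) * x θ ≤ c * lam (ind S) := by
  have h1 := h.sum_le (fun θ => x θ • ind S) (c • ind S) fun t => by
    change M.U (fun θ => x θ * (ind S).1 t) t ≤ c * (ind S).1 t
    by_cases ht : t ∈ S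
    · simpa only [ind_of_mem ht, mul_one] using hc t ht
    · simp only [ind_of_notMem ht, mul_zero]
      exact (U_zero (M := M) (t : M.T)).le
  simp only [map_smul, smul_eq_mul] at h1
  simpa only [mul_comm] using h1

end IsMultiplier

/-! ### Slater's condition -/

/-- Rapidly decreasing weights: each one dominates all the later ones. -/
lemma exists_dominating_weights {α : Type*} [LinearOrder α] (G : Finset α) {d K : ℝ} (hd : 0 < d)
    (hK : 0 ≤ K) :
    ∃ π : α → ℝ, (∀ i, 0 ≤ π i) ∧ ∀ k ∈ G, K * ∑ j ∈ G with k < j, π j + 1 ≤ d * π k := by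
  induction G using Finset.induction_on_min with
  | empty => exact ⟨0, fun _ => le_rfl, by simp⟩
  | insert a s has ih =>
    obtain ⟨π, h0, h1⟩ := ih
    have hna : a ∉ s := fun h => lt_irrefl a (has a h)
    have hsum : ∀ s' ⊆ s, ∀ c : ℝ, ∑ j ∈ s', Function.update π a c j = ∑ j ∈ s', π j :=
      fun s' hs' c => Finset.sum_congr rfl fun j hj =>
        Function.update_of_ne (ne_of_mem_of_not_mem (hs' hj) hna) _ _
    refine ⟨Function.update π a ((K * ∑ j ∈ s, π j + 1) / d), fun i => ?_, fun k hk => ?_⟩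
    · rcases eq_or_ne i a with rfl | hi
      · rw [Function.update_self]
        have := Finset.sum_nonneg fun j (_ : j ∈ s) => h0 j
        positivity
      · rw [Function.update_of_ne hi]
        exact h0 i
    · rcases Finset.mem_insert.1 hk with rfl | hk
      · rw [Finset.filter_insert, if_neg (lt_irrefl k), Finset.filter_true_of_mem has,
          hsum s subset_rfl, Function.update_self, mul_div_cancel₀ _ hd.ne']
      · rw [Finset.filter_insert, if_neg (has k hk).not_gt, hsum _ (Finset.filter_subset _ _),
          Function.update_of_ne (ne_of_mem_of_not_mem hk hna)]
        exact h1 k hk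

open Classical in
/-- The belief-time pair in which the state `θ` is known at the date `g`. -/
def revealPt (M : Model Θ A) (g : M.T) (θ : Θ) : M.D :=
  (⟨Pi.single θ 1, single_mem_stdSimplex ℝ θ⟩, g)

/-- The measure which reveals the state at the dates `g` of the grid `G`, with mass `π g`. -/
def reveal (M : Model Θ A) (G : Finset M.T) (π : M.T → ℝ) : M.D →₀ ℝ :=
  ∑ g ∈ G, ∑ θ, Finsupp.single (M.revealPt g θ) (π g * M.prior θ)

lemma sum_prior_mul_revealPt (g : M.T) (θ : Θ) :
    ∑ θ', M.prior θ' * (M.revealPt g θ').1 θ = M.prior θ := by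
  classical
  rw [Finset.sum_eq_single θ]
  · change _ * (Pi.single θ 1 : Θ → ℝ) θ = _
    simp
  · intro θ' _ hne
    change _ * (Pi.single θ' 1 : Θ → ℝ) θ = 0
    simp [hne.symm]
  · simp

lemma sum_prior_mul_U_revealPt (g : M.T) :
    ∑ θ, M.prior θ * M.U (M.revealPt g θ).1 (M.revealPt g θ).2 = M.fullInfoValue g := rfl

lemma abs_fullInfoValue_le (t : M.T) : |M.fullInfoValue t| ≤ M.bd := by
  have h : ∀ θ, |M.U (M.revealPt t θ).1 (M.revealPt t θ).2| ≤ M.bd := fun θ =>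
    abs_U_simplex_le _ _
  have := abs_sum_mul_le (x := M.prior) h
  rw [sum_abs_simplex, mul_one] at this
  simpa only [← sum_prior_mul_U_revealPt, mul_comm] using this

lemma reveal_nonneg (G : Finset M.T) {π : M.T → ℝ} (hπ : ∀ g, 0 ≤ π g) (p : M.D) :
    0 ≤ M.reveal G π p := by
  classical
  simp only [reveal, Finsupp.coe_finsetSum, Finset.sum_apply]
  refine Finset.sum_nonneg fun g _ => Finset.sum_nonneg fun θ _ => ?_
  rw [Finsupp.single_apply]
  split_ifs
  exacts [mul_nonneg (hπ g) (M.prior.2.1 θ), le_rfl]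

lemma wsum_reveal (G : Finset M.T) (π : M.T → ℝ) (h : M.D → ℝ) :
    wsum h (M.reveal G π) = ∑ g ∈ G, π g * ∑ θ, M.prior θ * h (M.revealPt g θ) := by
  simp only [reveal, map_sum, wsum, Finsupp.linearCombination_single, smul_eq_mul, mul_assoc,
    Finset.mul_sum]

lemma wsum_after_reveal (G : Finset M.T) (π : M.T → ℝ) (t : M.T) (h : M.D → ℝ) :
    wsum ((M.after t).indicator h) (M.reveal G π) =
      ∑ g ∈ G with t < g, π g * ∑ θ, M.prior θ * h (M.revealPt g θ) := by
  rw [wsum_reveal, Finset.sum_filter]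
  refine Finset.sum_congr rfl fun g _ => ?_
  split_ifs with hg
  · refine congrArg _ (Finset.sum_congr rfl fun θ _ => ?_)
    rw [indicator_of_mem (show M.revealPt g θ ∈ M.after t from hg)]
  · rw [Finset.sum_eq_zero fun θ _ => ?_, mul_zero]
    rw [indicator_of_notMem (show M.revealPt g θ ∉ M.after t from hg), mul_zero]

lemma wpooled_reveal (G : Finset M.T) (π : M.T → ℝ) (t : M.T) :
    wpooled (M.reveal G π) t = (∑ g ∈ G with t < g, π g) • (M.prior : Θ → ℝ) := by
  ext θ
  rw [wpooled, wsum_after_reveal, Pi.smul_apply, smul_eq_mul, Finset.sum_mul]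
  exact Finset.sum_congr rfl fun g _ => by rw [sum_prior_mul_revealPt]

lemma wgain_reveal (G : Finset M.T) (π : M.T → ℝ) (t : M.T) :
    wgain (M.reveal G π) t = ∑ g ∈ G with t < g, π g * M.fullInfoValue g := by
  simp only [wgain, wsum_after_reveal, sum_prior_mul_U_revealPt]

/-- Slater's condition holds if there is a finite grid of dates such that, at each `t`, waiting for
full information at the first date of the grid after `t` beats acting on the prior at `t`: the
measure that reveals the state at the dates of the grid, with rapidly decreasing weights, has
slack. -/
lemma slater_of_grid (G : Finset M.T) {d : ℝ} (hd : 0 < d)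
    (hG : ∀ t ∈ M.Tcirc, ∃ k ∈ G, t < k ∧ (∀ j ∈ G, t < j → k ≤ j) ∧
      M.U M.prior t + d ≤ M.fullInfoValue k) : M.Slater := by
  classical
  obtain ⟨π, hπ0, hπ⟩ := exists_dominating_weights G hd (K := 2 * M.bd)
    (mul_nonneg zero_le_two M.bd_nonneg)
  have hone : ∀ t : M.Tcirc, (1 : ℝ) ≤ (ind univ : boundedFn M.Tcirc).1 t := fun t =>
    (ind_of_mem (mem_univ t)).ge
  refine ⟨wsum (fun p => M.V p.1 p.2) (M.reveal G π), ∑ g ∈ G, π g, 1, ind univ, one_pos,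
    hone, ?_⟩
  refine mem_attainable.2 ⟨M.reveal G π, reveal_nonneg G hπ0, le_rfl, fun θ => ?_, fun t => ?_⟩
  · rw [wsum_reveal, Pi.smul_apply, smul_eq_mul, Finset.sum_mul]
    exact Finset.sum_congr rfl fun g _ => by rw [sum_prior_mul_revealPt]
  · obtain ⟨k, hk, htk, hmin, hkd⟩ := hG t t.2
    have hfilter : ({g ∈ G | (t : M.T) < g} : Finset M.T) = insert k {g ∈ G | k < g} := by
      ext g
      simp only [Finset.mem_filter, Finset.mem_insert]
      constructor
      · rintro ⟨h1, h2⟩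
        rcases (hmin g h1 h2).eq_or_lt with h | h
        exacts [Or.inl h.symm, Or.inr ⟨h1, h⟩]
      · rintro (rfl | ⟨h1, h2⟩)
        exacts [⟨hk, htk⟩, ⟨h1, htk.trans h2⟩]
    have hpool : wpooled (M.reveal G π) t + (fun θ => ((0 : Θ → boundedFn M.Tcirc) θ).1 t) =
        (∑ g ∈ G with (t : M.T) < g, π g) • (M.prior : Θ → ℝ) := by
      rw [← wpooled_reveal]
      exact add_zero _
    rw [hpool, U_smul (Finset.sum_nonneg fun g _ => hπ0 g), wgain_reveal, Finset.sum_mul,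
      ← Finset.sum_sub_distrib, ind_of_mem (mem_univ t), hfilter,
      Finset.sum_insert (by simp)]
    have h1 : -(2 * M.bd * ∑ g ∈ G with k < g, π g) ≤
        ∑ g ∈ G with k < g, (π g * M.fullInfoValue g - π g * M.U M.prior t) := by
      rw [Finset.mul_sum, ← Finset.sum_neg_distrib]
      refine Finset.sum_le_sum fun g _ => ?_
      have h2 := neg_le_of_abs_le (abs_fullInfoValue_le (M := M) g)
      have h3 := le_of_abs_le (abs_U_simplex_le M.prior (t : M.T))
      nlinarith [hπ0 g]
    have h4 := hπ k hk
    have h5 := mul_le_mul_of_nonneg_left hkd (hπ0 k)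
    linarith

lemma fullInfoValue_anti {s t : M.T} (h : s ≤ t) : M.fullInfoValue t ≤ M.fullInfoValue s :=
  Finset.sum_le_sum fun θ _ => mul_le_mul_of_nonneg_left (U_le_U_of_le _ h) (M.prior.2.1 θ)

lemma slater_of_finite (hT : M.T.Finite) (hwait : M.WaitingValuable) : M.Slater := by
  classical
  have : Finite M.T := hT
  have : Fintype M.T := Fintype.ofFinite _
  have : Nonempty M.T := M.nonempty_T.to_subtype
  have h : ∀ t : M.T, ∃ d > 0, t ∈ M.Tcirc → ∃ k ∈ Finset.univ, t < k ∧
      (∀ j ∈ Finset.univ, t < j → k ≤ j) ∧ M.U M.prior t + d ≤ M.fullInfoValue k := fun t => by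
    by_cases ht : t ∈ M.Tcirc
    · obtain ⟨s, hs, hlt⟩ := hwait t ht
      have hne : (Finset.univ.filter fun j : M.T => t < j).Nonempty := ⟨s, by simpa using hs⟩
      refine ⟨M.fullInfoValue s - M.U M.prior t, sub_pos.2 hlt, fun _ =>
        ⟨_, Finset.mem_univ _, (Finset.mem_filter.1 (Finset.min'_mem _ hne)).2,
          fun j _ hj => Finset.min'_le _ _ (by simpa using hj), ?_⟩⟩
      have := fullInfoValue_anti (M := M) (Finset.min'_le (Finset.univ.filter fun j : M.T => t < j)
        s (by simpa using hs))
      linarith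
    · exact ⟨1, one_pos, fun h => absurd h ht⟩
  choose d hd h using h
  obtain ⟨t₀, ht₀⟩ := Finite.exists_min d
  refine slater_of_grid Finset.univ (hd t₀) fun t ht => ?_
  obtain ⟨k, h1, h2, h3, h4⟩ := h t ht
  exact ⟨k, h1, h2, h3, by linarith [ht₀ t]⟩

lemma continuous_U_time (hcont : M.Continuity) (μ : stdSimplex ℝ Θ) :
    Continuous fun t : M.T => M.U μ t :=
  hcont.1.comp (continuous_const.prodMk continuous_id)

lemma slater_of_interval {b c : ℝ} (hT : M.T = Icc b c) (hinfo : M.InfoValuable)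
    (hcont : M.Continuity) : M.Slater := by
  classical
  have hbc : b ≤ c := nonempty_Icc.1 (hT ▸ M.nonempty_T)
  have hmem : ∀ {x}, x ∈ M.T ↔ b ≤ x ∧ x ≤ c := fun {x} => by rw [hT]; rfl
  have hsup : sSup M.T = c := by rw [hT, csSup_Icc hbc]
  have : Nonempty M.T := M.nonempty_T.to_subtype
  have : CompactSpace M.T := isCompact_iff_compactSpace.1 M.isCompact_T
  have hfc : Continuous M.fullInfoValue := by
    refine continuous_finsetSum _ fun θ _ => continuous_const.mul ?_
    exact continuous_U_time hcont ⟨Pi.single θ 1, single_mem_stdSimplex ℝ θ⟩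
  -- The value of full information, net of the value of the prior, is bounded away from zero, and
  -- by uniform continuity it changes little within any window of length `ε`.
  obtain ⟨t₀, -, ht₀⟩ := isCompact_univ.exists_isMinOn univ_nonempty
    (hfc.sub (continuous_U_time hcont M.prior)).continuousOn
  have hd : 0 < M.fullInfoValue t₀ - M.U M.prior t₀ := sub_pos.2 (hinfo t₀)
  set d := M.fullInfoValue t₀ - M.U M.prior t₀
  obtain ⟨ε, hε, hunif⟩ := Metric.uniformContinuous_iff.1
    (CompactSpace.uniformContinuous_of_continuous hfc) (d / 2) (half_pos hd)
  obtain ⟨N, -, hNfin, hN⟩ := finite_cover_balls_of_compact (isCompact_univ (X := M.T))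
    (half_pos hε)
  let top : M.T := ⟨c, hmem.2 ⟨hbc, le_rfl⟩⟩
  let G : Finset M.T := insert top hNfin.toFinset
  refine slater_of_grid G (half_pos hd) fun t ht => ?_
  have htc : (t : ℝ) < c := lt_of_le_of_ne (hmem.1 t.2).2 fun h => ht (h.trans hsup.symm)
  have hnear : ∃ k ∈ G, t < k ∧ (k : ℝ) < t + ε := by
    rcases lt_or_ge c (t + ε) with h | h
    · exact ⟨top, Finset.mem_insert_self _ _, htc, h⟩
    · have hmid : (t : ℝ) + ε / 2 ∈ M.T := hmem.2 ⟨by linarith [(hmem.1 t.2).1], by linarith⟩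
      obtain ⟨k, hkN, hk⟩ := mem_iUnion₂.1 (hN (mem_univ ⟨(t : ℝ) + ε / 2, hmid⟩))
      rw [Metric.mem_ball, Subtype.dist_eq, Real.dist_eq, abs_lt] at hk
      refine ⟨k, Finset.mem_insert_of_mem (hNfin.mem_toFinset.2 hkN), ?_, ?_⟩
      · rw [← Subtype.coe_lt_coe]
        linarith [hk.2]
      · linarith [hk.1]
  obtain ⟨k₀, hk₀, hlt, hk₀ε⟩ := hnear
  have hne : (G.filter fun j : M.T => t < j).Nonempty := ⟨k₀, Finset.mem_filter.2 ⟨hk₀, hlt⟩⟩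
  obtain ⟨hkG, htk⟩ := Finset.mem_filter.1 (Finset.min'_mem _ hne)
  have hkk₀ := Finset.min'_le (G.filter fun j : M.T => t < j) k₀ (Finset.mem_filter.2 ⟨hk₀, hlt⟩)
  refine ⟨_, hkG, htk, fun j hj hj' => Finset.min'_le _ _ (Finset.mem_filter.2 ⟨hj, hj'⟩), ?_⟩
  set k := (G.filter fun j : M.T => t < j).min' hne
  have h1 : dist k t < ε := by
    rw [Subtype.dist_eq, Real.dist_eq, abs_lt]
    have h2 : (t : ℝ) < k := htk
    have h3 : (k : ℝ) ≤ k₀ := hkk₀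
    constructor <;> linarith
  have h2 := (abs_lt.1 (Real.dist_eq _ _ ▸ hunif h1)).1
  have h3 : d ≤ M.fullInfoValue t - M.U M.prior t := ht₀ (mem_univ t)
  linarith

/-! ### Representing measures when there are finitely many dates -/

lemma ind_eq_sum {ι : Type*} [Fintype ι] (S : Set ι) :
    ind S = ∑ t, S.indicator (1 : ι → ℝ) t • ind {t} := by
  ext s
  rw [Submodule.coe_sum, Finset.sum_apply, Finset.sum_eq_single s]
  · change _ = S.indicator 1 s * (ind {s} : ι → ℝ) s
    rw [ind_of_mem (mem_singleton s), mul_one, ind_apply]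
  · intro t _ hne
    change S.indicator 1 t * (ind {t} : ι → ℝ) s = 0
    rw [ind_of_notMem (show s ∉ ({t} : Set ι) from hne.symm), mul_zero]
  · simp

lemma ind_nonneg {ι : Type*} (S : Set ι) (i : ι) : 0 ≤ (ind S).1 i :=
  indicator_nonneg (fun _ _ => zero_le_one) i

/-- With finitely many dates the functionals are sums of point masses, and `γ_t` is the ratio of
the weights of `Γ` and `lam` at `t`. -/
theorem IsMultiplier.exists_measure_of_finite (hT : M.T.Finite) {a : Θ → ℝ}
    {lam : boundedFn M.Tcirc →ₗ[ℝ] ℝ} {Γ : Θ → boundedFn M.Tcirc →ₗ[ℝ] ℝ}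
    (h : M.IsMultiplier a lam Γ) :
    ∃ (Λ : FiniteMeasure M.Tcirc) (γ : M.Tcirc → Θ → ℝ),
      (∀ θ, Integrable (fun t => γ t θ) (Λ : Measure M.Tcirc)) ∧
      (∀ᵐ t ∂(Λ : Measure M.Tcirc), ∀ y : Θ → ℝ, (∀ θ, 0 ≤ y θ) →
        ∑ θ, γ t θ * y θ ≤ M.U y t) ∧
      ∀ p : M.D, M.deriv Λ γ p ≤ ∑ θ, a θ * p.1 θ := by
  classical
  have : Finite M.T := hT
  have : Fintype M.Tcirc := Fintype.ofFinite _
  let l : M.Tcirc → ℝ := fun t => lam (ind {t})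
  have hl : ∀ t, 0 ≤ l t := fun t => h.nonneg _ (ind_nonneg _)
  let ν : Measure M.Tcirc := ∑ t, ENNReal.ofReal (l t) • Measure.dirac t
  have hν : IsFiniteMeasure ν := by
    constructor
    simp only [ν, Measure.coe_finsetSum, Finset.sum_apply, Measure.smul_apply, measure_univ,
      smul_eq_mul, mul_one]
    exact ENNReal.sum_lt_top.2 fun t _ => ENNReal.ofReal_lt_top
  let Λ : FiniteMeasure M.Tcirc := ⟨ν, hν⟩
  let γ : M.Tcirc → Θ → ℝ := fun t θ => Γ θ (ind {t}) / l t
  have hΓ : ∀ t θ, l t * γ t θ = Γ θ (ind {t}) := fun t θ => by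
    by_cases h0 : l t = 0
    · have h1 := h.abs_le θ (ind_nonneg {t})
      rw [show lam (ind {t}) = 0 from h0, mul_zero] at h1
      rw [h0, zero_mul, abs_eq_zero.1 (le_antisymm h1 (abs_nonneg _))]
    · exact mul_div_cancel₀ _ h0
  have hint : ∀ (g : M.Tcirc → ℝ) (S : Set M.Tcirc), ∫ t in S, g t ∂ν =
      ∑ t, S.indicator (1 : M.Tcirc → ℝ) t * (l t * g t) := fun g S => by
    rw [← integral_indicator (Set.toFinite S).measurableSet,
      integral_finsetSum_measure fun p _ =>
        (integrable_dirac (by simp)).smul_measure ENNReal.ofReal_ne_top]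
    refine Finset.sum_congr rfl fun t _ => ?_
    rw [integral_smul_measure, integral_dirac, ENNReal.toReal_ofReal (hl t), smul_eq_mul]
    by_cases ht : t ∈ S <;> simp [ht]
  have hΛreal : ∀ S : Set M.Tcirc, ν.real S = lam (ind S) := fun S => by
    have h1 := hint (fun _ => 1) S
    simp only [integral_const, smul_eq_mul, mul_one, measureReal_restrict_apply_univ] at h1
    rw [h1, ind_eq_sum S, map_sum]
    exact Finset.sum_congr rfl fun t _ => by rw [map_smul, smul_eq_mul]
  have hγint : ∀ (S : Set M.Tcirc) θ, ∫ t in S, γ t θ ∂ν = Γ θ (ind S) := fun S θ => by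
    rw [hint, ind_eq_sum S, map_sum]
    exact Finset.sum_congr rfl fun t _ => by rw [map_smul, smul_eq_mul, hΓ]
  refine ⟨Λ, γ, fun θ => Integrable.of_finite, ?_, fun p => ?_⟩
  · have hpos : ∀ᵐ t ∂ν, l t ≠ 0 := by
      rw [ae_iff]
      simp only [ν, Measure.coe_finsetSum, Finset.sum_apply, Measure.smul_apply, smul_eq_mul]
      refine Finset.sum_eq_zero fun t _ => ?_
      by_cases h0 : l t = 0
      · simp [h0]
      · rw [Measure.dirac_apply, indicator_of_notMem (by simpa using h0), mul_zero]
    filter_upwards [hpos] with t ht y _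
    have h1 := h.sum_ind_le y (S := {t}) (c := M.U y t) fun s hs => by rw [mem_singleton_iff.1 hs]
    refine le_of_mul_le_mul_left ?_ ((hl t).lt_of_ne' ht)
    rw [mul_comm (l t) (M.U y t), Finset.mul_sum]
    refine le_trans (le_of_eq (Finset.sum_congr rfl fun θ _ => ?_)) h1
    rw [← mul_assoc, hΓ]
  · refine le_trans (le_of_eq ?_) (h.foc p)
    change M.V p.1 p.2 + ν.real _ * _ - ∑ θ, (∫ τ in _, γ τ θ ∂ν) * _ = _
    simp only [hΛreal, hγint]

/-! ### Densities of functions dominated by a monotone function -/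

section Density

open Filter Topology Function

lemma leftLim_stieltjesFunction {N : ℝ → ℝ} (hN : Monotone N) (r : ℝ) :
    leftLim hN.stieltjesFunction r = leftLim N r :=
  leftLim_rightLim (hN.tendsto_leftLim r)

lemma tendsto_stieltjes_Ico {N : ℝ → ℝ} (hN : Monotone N) {b : ℝ} (h0 : ∀ r ≤ b, N r = 0)
    (r : ℝ) (hr : b ≤ r) :
    Tendsto N (𝓝[<] r) (𝓝 (hN.stieltjesFunction.measure.real (Ico b r))) := by
  have hb : leftLim N b = 0 := leftLim_eq_of_tendsto
    (tendsto_const_nhds.congr' (by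
      filter_upwards [self_mem_nhdsWithin] with s hs using (h0 s (le_of_lt hs)).symm))
  rw [Measure.real, StieltjesFunction.measure_Ico, leftLim_stieltjesFunction,
    leftLim_stieltjesFunction, hb, sub_zero, ENNReal.toReal_ofReal]
  · exact hN.tendsto_leftLim r
  · rw [← hb]
    exact hN.leftLim hr

lemma tendsto_stieltjes_closedBall {N : ℝ → ℝ} (hN : Monotone N) (t : ℝ) {ρ : ℝ} (hρ : 0 < ρ) :
    Tendsto (fun q : ℝ × ℝ => N q.2 - N q.1) (𝓝[<] (t - ρ) ×ˢ 𝓝[>] (t + ρ))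
      (𝓝 (hN.stieltjesFunction.measure.real (Metric.closedBall t ρ))) := by
  rw [Measure.real, Real.closedBall_eq_Icc, StieltjesFunction.measure_Icc,
    leftLim_stieltjesFunction, hN.stieltjesFunction_eq, ENNReal.toReal_ofReal]
  · exact ((hN.tendsto_rightLim _).comp tendsto_snd).sub ((hN.tendsto_leftLim _).comp tendsto_fst)
  · exact sub_nonneg.2 (hN.leftLim_le_rightLim (by linarith))

lemma isFiniteMeasure_stieltjes {N : ℝ → ℝ} (hN : Monotone N) {K : ℝ} (hK : ∀ r, |N r| ≤ K) :
    IsFiniteMeasure hN.stieltjesFunction.measure := by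
  refine StieltjesFunction.isFiniteMeasure_of_forall_abs_le _ (C := K) fun r => abs_le.2 ⟨?_, ?_⟩
  · exact (abs_le.1 (hK r)).1.trans (hN.le_rightLim le_rfl)
  · exact (hN.rightLim_le (lt_add_one r)).trans (abs_le.1 (hK _)).2

/-- If the increments of `N` are at most `C` times those of `m`, then the Stieltjes measure of `N` is
at most `C` times that of `m`. -/
lemma stieltjes_absolutelyContinuous {m N : ℝ → ℝ} (hm : Monotone m) (hN : Monotone N) {C : ℝ}
    (hC : 0 ≤ C) (hle : Monotone fun r => C * m r - N r) :
    hN.stieltjesFunction.measure ≪ hm.stieltjesFunction.measure := by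
  let c : NNReal := ⟨C, hC⟩
  have h : hN.stieltjesFunction + hle.stieltjesFunction =
      c • hm.stieltjesFunction := by
    ext r
    have h1 : Tendsto (fun r => C * m r - N r) (𝓝[>] r) (𝓝 (C * rightLim m r - rightLim N r)) :=
      ((hm.tendsto_rightLim r).const_mul C).sub (hN.tendsto_rightLim r)
    have h2 := tendsto_nhds_unique h1 (hle.tendsto_rightLim r)
    change rightLim N r + rightLim (fun r => C * m r - N r) r = C * rightLim m r
    rw [← h2]
    ring
  have h2 : hN.stieltjesFunction.measure ≤
      c • hm.stieltjesFunction.measure := by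
    rw [← StieltjesFunction.measure_smul, ← h, StieltjesFunction.measure_add]
    exact Measure.le_add_right le_rfl
  exact (Measure.absolutelyContinuous_of_le h2).trans Measure.smul_absolutelyContinuous

/-- Functions `F θ` whose increments are dominated by those of a bounded monotone function `m` are,
up to left limits, the integrals of densities `g θ` with respect to the Stieltjes measure of `m`.
By the differentiation theorem, linear inequalities between the increments of the `F θ` and those of
`m` near `t` pass to the densities at almost every `t`. -/
theorem exists_density {m : ℝ → ℝ} (hm : Monotone m) {F : Θ → ℝ → ℝ} {b C K : ℝ}
    (hC : 0 ≤ C) (hF : ∀ θ s r, s ≤ r → |F θ r - F θ s| ≤ C * (m r - m s))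
    (hm0 : ∀ r ≤ b, m r = 0) (hF0 : ∀ θ, ∀ r ≤ b, F θ r = 0) (hmK : ∀ r, |m r| ≤ K) :
    ∃ (ν : Measure ℝ) (g : Θ → ℝ → ℝ), IsFiniteMeasure ν ∧ (∀ θ, Integrable (g θ) ν) ∧
      (∀ r, b ≤ r → Tendsto m (𝓝[<] r) (𝓝 (ν.real (Ico b r)))) ∧
      (∀ θ r, b ≤ r → Tendsto (F θ) (𝓝[<] r) (𝓝 (∫ t in Ico b r, g θ t ∂ν))) ∧
      ∀ᵐ t ∂ν, ∀ (x : Θ → ℝ) (c δ : ℝ), 0 < δ →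
        (∀ s r, t - δ < s → s < t → t < r → ∑ θ, (F θ r - F θ s) * x θ ≤ c * (m r - m s)) →
        ∑ θ, g θ t * x θ ≤ c := by
  -- Adding a multiple of `m` makes the `F θ` monotone; it is subtracted again from the densities.
  let N : Θ → ℝ → ℝ := fun θ r => F θ r + C * m r
  have hN : ∀ θ, Monotone (N θ) := fun θ s r hsr => by
    have := (abs_le.1 (hF θ s r hsr)).1
    simp only [N]
    linarith
  have hN' : ∀ θ, Monotone fun r => 2 * C * m r - N θ r := fun θ s r hsr => by
    have := (abs_le.1 (hF θ s r hsr)).2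
    simp only [N]
    linarith
  have hNK : ∀ θ r, |N θ r| ≤ 2 * C * K := fun θ r => by
    have h1 : |F θ r| ≤ C * |m r| := by
      rcases le_total b r with h | h
      · have := hF θ b r h
        rw [hF0 θ b le_rfl, hm0 b le_rfl, sub_zero, sub_zero] at this
        exact this.trans (mul_le_mul_of_nonneg_left (le_abs_self _) hC)
      · rw [hF0 θ r h, abs_zero]
        exact mul_nonneg hC (abs_nonneg _)
    have h2 := mul_le_mul_of_nonneg_left (hmK r) hC
    refine (abs_add_le _ _).trans ?_
    rw [abs_mul, abs_of_nonneg hC]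
    linarith
  have hN0 : ∀ θ, ∀ r ≤ b, N θ r = 0 := fun θ r hr => by
    simp only [N, hF0 θ r hr, hm0 r hr]
    ring
  let ν := hm.stieltjesFunction.measure
  let κ : Θ → Measure ℝ := fun θ => (hN θ).stieltjesFunction.measure
  have hν : IsFiniteMeasure ν := isFiniteMeasure_stieltjes hm hmK
  have hκ : ∀ θ, IsFiniteMeasure (κ θ) := fun θ => isFiniteMeasure_stieltjes (hN θ) (hNK θ)
  have hac : ∀ θ, κ θ ≪ ν := fun θ =>
    stieltjes_absolutelyContinuous hm (hN θ) (mul_nonneg zero_le_two hC) (hN' θ)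
  let g : Θ → ℝ → ℝ := fun θ t => ((κ θ).rnDeriv ν t).toReal - C
  have hgi : ∀ θ, Integrable (g θ) ν := fun θ =>
    Measure.integrable_toReal_rnDeriv.sub (integrable_const C)
  refine ⟨ν, g, hν, hgi, tendsto_stieltjes_Ico hm hm0, fun θ r hr => ?_, ?_⟩
  · have h1 : ∫ t in Ico b r, g θ t ∂ν = (κ θ).real (Ico b r) - C * ν.real (Ico b r) := by
      rw [integral_sub Measure.integrable_toReal_rnDeriv.integrableOn
        (integrable_const C).integrableOn, Measure.setIntegral_toReal_rnDeriv (hac θ),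
        setIntegral_const, smul_eq_mul, mul_comm]
    rw [h1]
    refine ((tendsto_stieltjes_Ico (hN θ) (hN0 θ) r hr).sub
      ((tendsto_stieltjes_Ico hm hm0 r hr).const_mul C)).congr fun s => ?_
    simp only [N]
    ring
  · have h1 : ∀ᵐ t ∂ν, ∀ θ, Tendsto (fun ρ => κ θ (Metric.closedBall t ρ) /
        ν (Metric.closedBall t ρ)) (𝓝[>] 0) (𝓝 ((κ θ).rnDeriv ν t)) :=
      ae_all_iff.2 fun θ => Besicovitch.ae_tendsto_rnDeriv (κ θ) ν
    have h2 : ∀ᵐ t ∂ν, ∀ θ, (κ θ).rnDeriv ν t ≠ ⊤ :=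
      ae_all_iff.2 fun θ => (κ θ).rnDeriv_ne_top ν
    filter_upwards [h1, h2, ν.support_mem_ae] with t ht1 ht2 ht3 x c δ hδ hinc
    have hlim : Tendsto (fun ρ => ∑ θ, ((κ θ).real (Metric.closedBall t ρ) /
        ν.real (Metric.closedBall t ρ) - C) * x θ) (𝓝[>] 0) (𝓝 (∑ θ, g θ t * x θ)) := by
      refine tendsto_finsetSum _ fun θ _ => Tendsto.mul_const _ (Tendsto.sub_const ?_ C)
      refine ((ENNReal.tendsto_toReal (ht2 θ)).comp (ht1 θ)).congr fun ρ => ?_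
      exact ENNReal.toReal_div _ _
    refine le_of_tendsto hlim ?_
    filter_upwards [self_mem_nhdsWithin, mem_nhdsWithin_of_mem_nhds (Iio_mem_nhds hδ)]
      with ρ (hρ : 0 < ρ) (hρδ : ρ < δ)
    have hpos : 0 < ν.real (Metric.closedBall t ρ) :=
      ENNReal.toReal_pos ((Measure.mem_support_iff_forall t).1 ht3 _
        (Metric.closedBall_mem_nhds t hρ)).ne' (measure_ne_top _ _)
    have hball : ∑ θ, ((κ θ).real (Metric.closedBall t ρ) -
        C * ν.real (Metric.closedBall t ρ)) * x θ ≤ c * ν.real (Metric.closedBall t ρ) := by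
      have hlm := tendsto_stieltjes_closedBall hm t hρ
      refine le_of_tendsto_of_tendsto (tendsto_finsetSum _ fun θ _ =>
        ((tendsto_stieltjes_closedBall (hN θ) t hρ).sub (hlm.const_mul C)).mul_const (x θ))
        (hlm.const_mul c) ?_
      have hs : ∀ᶠ s in 𝓝[<] (t - ρ), t - δ < s ∧ s < t - ρ :=
        Ioo_mem_nhdsLT (by linarith)
      have hr : ∀ᶠ r in 𝓝[>] (t + ρ), t + ρ < r := self_mem_nhdsWithin
      filter_upwards [hs.prod_mk hr] with q hq
      refine le_trans (le_of_eq (Finset.sum_congr rfl fun θ _ => ?_))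
        (hinc q.1 q.2 hq.1.1 (by linarith [hq.1.2]) (by linarith [hq.2]))
      simp only [N]
      ring
    refine le_of_mul_le_mul_right ?_ hpos
    refine le_trans (le_of_eq ?_) hball
    rw [Finset.sum_mul]
    refine Finset.sum_congr rfl fun θ _ => ?_
    field_simp

end Density

/-! ### Representing measures when time is an interval -/

lemma ind_eq_add_diff {ι : Type*} {S S' : Set ι} (h : S ⊆ S') : ind S' = ind S + ind (S' \ S) := by
  ext i
  change (ind S' : ι → ℝ) i = (ind S : ι → ℝ) i + (ind (S' \ S) : ι → ℝ) i
  by_cases h1 : i ∈ S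
  · rw [ind_of_mem h1, ind_of_mem (h h1), ind_of_notMem fun h2 => h2.2 h1, add_zero]
  · by_cases h2 : i ∈ S'
    · rw [ind_of_notMem h1, ind_of_mem h2, ind_of_mem (show i ∈ S' \ S from ⟨h2, h1⟩),
        zero_add]
    · rw [ind_of_notMem h1, ind_of_notMem h2, ind_of_notMem fun h3 => h2 h3.1, add_zero]

lemma ind_empty {ι : Type*} : ind (∅ : Set ι) = 0 := by
  ext i
  exact ind_of_notMem (notMem_empty i)

lemma continuous_U_time_of_nonneg (hcont : M.Continuity) {x : Θ → ℝ} (hx : ∀ θ, 0 ≤ x θ) :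
    Continuous fun t : M.T => M.U x t := by
  have hs : 0 ≤ ∑ θ, x θ := Finset.sum_nonneg fun θ _ => hx θ
  simp only [← fun t => Uext_eq_U (M := M) hx t, Uext]
  rcases hs.eq_or_lt with h | h
  · simp only [← h, zero_mul]
    exact continuous_const
  · exact continuous_const.mul (continuous_U_time hcont ⟨(∑ θ, x θ)⁻¹ • x,
      fun θ => mul_nonneg (inv_nonneg.2 hs) (hx θ), by
        simp [← Finset.mul_sum, inv_mul_cancel₀ h.ne']⟩)

/-- On an interval, `Λ` is the Stieltjes measure of `r ↦ lam 1_{t < r}`, restricted to `T°`, and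
`γ` is the density of `r ↦ Γ 1_{t < r}`. The two functions need not be left continuous, so the
inequality of the first-order condition passes to their left limits by continuity of `U` and `V`
in time. -/
theorem IsMultiplier.exists_measure_of_interval {b c : ℝ} (hT : M.T = Icc b c)
    (hcont : M.Continuity) {a : Θ → ℝ}
    {lam : boundedFn M.Tcirc →ₗ[ℝ] ℝ} {Γ : Θ → boundedFn M.Tcirc →ₗ[ℝ] ℝ}
    (h : M.IsMultiplier a lam Γ) :
    ∃ (Λ : FiniteMeasure M.Tcirc) (γ : M.Tcirc → Θ → ℝ),
      (∀ θ, Integrable (fun t => γ t θ) (Λ : Measure M.Tcirc)) ∧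
      (∀ᵐ t ∂(Λ : Measure M.Tcirc), ∀ y : Θ → ℝ, (∀ θ, 0 ≤ y θ) →
        ∑ θ, γ t θ * y θ ≤ M.U y t) ∧
      ∀ p : M.D, M.deriv Λ γ p ≤ ∑ θ, a θ * p.1 θ := by
  have hbc : b ≤ c := nonempty_Icc.1 (hT ▸ M.nonempty_T)
  have hmem : ∀ {x}, x ∈ M.T ↔ b ≤ x ∧ x ≤ c := fun {x} => by rw [hT]; rfl
  have hsup : sSup M.T = c := by rw [hT, csSup_Icc hbc]
  let S : ℝ → Set M.Tcirc := fun r => {t | ((t : M.T) : ℝ) < r}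
  have hS : Monotone S := fun s r hsr t (ht : ((t : M.T) : ℝ) < s) => lt_of_lt_of_le ht hsr
  have hS0 : ∀ r ≤ b, ind (S r) = 0 := fun r hr => by
    rw [← ind_empty]
    congr 1
    refine eq_empty_of_forall_notMem fun t (ht : ((t : M.T) : ℝ) < r) => ?_
    linarith [(hmem.1 (t : M.T).2).1]
  have hmdiff : ∀ {s r}, s ≤ r → lam (ind (S r)) - lam (ind (S s)) = lam (ind (S r \ S s)) :=
    fun {s r} hsr => by rw [ind_eq_add_diff (hS hsr), map_add, add_sub_cancel_left]
  have hFdiff : ∀ θ {s r}, s ≤ r →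
      Γ θ (ind (S r)) - Γ θ (ind (S s)) = Γ θ (ind (S r \ S s)) :=
    fun θ {s r} hsr => by rw [ind_eq_add_diff (hS hsr), map_add, add_sub_cancel_left]
  have hm : Monotone fun r => lam (ind (S r)) := fun s r hsr => by
    have := h.nonneg _ (ind_nonneg (S r \ S s))
    rw [← hmdiff hsr] at this
    exact sub_nonneg.1 this
  obtain ⟨ν, g, hν, hgi, hmlim, hFlim, hgae⟩ := exists_density (m := fun r => lam (ind (S r))) hm
    (F := fun θ r => Γ θ (ind (S r))) (b := b) (C := M.bd) (K := lam (ind univ)) M.bd_nonneg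
    (fun θ s r hsr => by
      rw [hmdiff hsr, hFdiff θ hsr]
      exact h.abs_le θ (ind_nonneg _))
    (fun r hr => by rw [hS0 r hr, map_zero]) (fun θ r hr => by rw [hS0 r hr, map_zero])
    (fun r => by
      rw [abs_of_nonneg (h.nonneg _ (ind_nonneg _)), ind_eq_add_diff (subset_univ (S r)), map_add]
      exact le_add_of_nonneg_right (h.nonneg _ (ind_nonneg _)))
  let e : M.Tcirc → ℝ := fun t => ((t : M.T) : ℝ)
  have hTc : MeasurableSet M.Tcirc :=
    (measurableSet_eq_fun measurable_subtype_coe measurable_const).compl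
  have he : MeasurableEmbedding e :=
    (MeasurableEmbedding.subtype_coe M.isCompact_T.measurableSet).comp
      (MeasurableEmbedding.subtype_coe hTc)
  have hrange : range e = Ico b c := by
    ext r
    constructor
    · rintro ⟨t, rfl⟩
      exact ⟨(hmem.1 (t : M.T).2).1,
        lt_of_le_of_ne (hmem.1 (t : M.T).2).2 fun h => t.2 (h.trans hsup.symm)⟩
    · rintro ⟨h1, h2⟩
      exact ⟨⟨⟨r, hmem.2 ⟨h1, h2.le⟩⟩, fun h => h2.ne (h.trans hsup)⟩, rfl⟩
  have hmap : (ν.comap e).map e = ν.restrict (Ico b c) := by rw [he.map_comap, hrange]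
  have hfin : IsFiniteMeasure (ν.comap e) := by
    constructor
    rw [he.comap_apply]
    exact measure_lt_top _ _
  let Λ : FiniteMeasure M.Tcirc := ⟨ν.comap e, hfin⟩
  let γ : M.Tcirc → Θ → ℝ := fun t θ => g θ (e t)
  have hint : ∀ (k : ℝ → ℝ) (τ : M.T), ∫ t in M.before τ, k (e t) ∂(ν.comap e) =
      ∫ t in Ico b (τ : ℝ), k t ∂ν := fun k τ => by
    have h1 := he.setIntegral_map (μ := ν.comap e) k (Iio (τ : ℝ))
    rw [hmap, Measure.restrict_restrict measurableSet_Iio] at h1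
    have h2 : Iio (τ : ℝ) ∩ Ico b c = Ico b (τ : ℝ) := by
      ext r
      exact ⟨fun hr => ⟨hr.2.1, hr.1⟩, fun hr => ⟨hr.2, hr.1, hr.2.trans_le (hmem.1 τ.2).2⟩⟩
    rw [h2] at h1
    exact h1.symm
  have hreal : ∀ τ : M.T, (ν.comap e).real (M.before τ) = ν.real (Ico b (τ : ℝ)) := fun τ => by
    have h1 := hint (fun _ => 1) τ
    simpa only [integral_const, smul_eq_mul, mul_one, measureReal_restrict_apply_univ] using h1
  refine ⟨Λ, γ, fun θ => ?_, ?_, ?_⟩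
  · refine he.integrable_map_iff.1 ?_
    change Integrable (g θ) ((ν.comap e).map e)
    rw [hmap]
    exact (hgi θ).integrableOn
  · have h1 := ae_restrict_of_ae (s := Ico b c) hgae
    rw [← hmap, he.ae_map_iff] at h1
    filter_upwards [h1] with t ht y hy
    refine le_of_forall_pos_le_add fun ε hε => ?_
    obtain ⟨δ, hδ, hδU⟩ := Metric.continuous_iff.1 (continuous_U_time_of_nonneg hcont hy) t ε hε
    refine ht y (M.U y t + ε) δ hδ fun s r hs hst htr => ?_
    have hsr : s ≤ r := (hst.trans htr).le
    simp only [hFdiff _ hsr, hmdiff hsr]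
    refine h.sum_ind_le y fun t' ht' => ?_
    rcases le_total (t : M.T) t' with htt' | htt'
    · linarith [U_le_U_of_le (M := M) y htt']
    · have h2 : s ≤ ((t' : M.T) : ℝ) := not_lt.1 ht'.2
      have h3 : ((t' : M.T) : ℝ) ≤ ((t : M.T) : ℝ) := htt'
      have h4 : dist (t' : M.T) t < δ := by
        rw [Subtype.dist_eq, Real.dist_eq, abs_lt]
        constructor <;> linarith
      have h5 := (abs_lt.1 (Real.dist_eq _ _ ▸ hδU t' h4)).2
      linarith
  · rintro ⟨μ, τ⟩
    change M.V μ τ + (ν.comap e).real (M.before τ) * M.U μ τ -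
      ∑ θ, (∫ t in M.before τ, g θ (e t) ∂(ν.comap e)) * μ θ ≤ ∑ θ, a θ * μ θ
    simp only [hreal, hint]
    rcases (hmem.1 τ.2).1.eq_or_lt with hb | hb
    · have h1 := h.foc (μ, τ)
      have h2 : ind (M.before τ) = 0 := hS0 τ hb.ge
      simpa only [h2, map_zero, ← hb, Ico_self, measureReal_empty, Measure.restrict_empty,
        integral_zero_measure] using h1
    · let proj : ℝ → M.T := fun r => ⟨max b (min c r), hmem.2 ⟨le_max_left _ _,
        max_le hbc (min_le_left _ _)⟩⟩
      have hproj : Continuous proj := by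
        refine Continuous.subtype_mk ?_ _
        fun_prop
      have hprojr : ∀ r, b ≤ r → r ≤ c → ((proj r : M.T) : ℝ) = r := fun r h1 h2 => by
        change max b (min c r) = r
        rw [min_eq_right h2, max_eq_right h1]
      have hτ : proj τ = τ := Subtype.ext (hprojr τ (hmem.1 τ.2).1 (hmem.1 τ.2).2)
      have hV : Filter.Tendsto (fun r => M.V μ (proj r)) (nhdsWithin τ (Iio τ))
          (nhds (M.V μ τ)) := by
        have h1 := ((hcont.2.2.continuous μ).comp hproj).continuousWithinAt (s := Iio (τ : ℝ))
          (x := (τ : ℝ))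
        rw [ContinuousWithinAt, Function.comp_apply, hτ] at h1
        exact h1
      have hU : Filter.Tendsto (fun r => M.U μ (proj r)) (nhdsWithin τ (Iio τ))
          (nhds (M.U μ τ)) := by
        have h1 := ((continuous_U_time hcont μ).comp hproj).continuousWithinAt
          (s := Iio (τ : ℝ)) (x := (τ : ℝ))
        rw [ContinuousWithinAt, Function.comp_apply, hτ] at h1
        exact h1
      refine le_of_tendsto ((hV.add ((hmlim τ hb.le).mul hU)).sub
        (tendsto_finsetSum _ fun θ _ => (hFlim θ τ hb.le).mul_const (μ θ))) ?_
      filter_upwards [Ioo_mem_nhdsLT hb] with r hr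
      have h1 := h.foc (μ, proj r)
      have h2 : M.before (proj r) = S r := by
        change S (proj r : ℝ) = S r
        rw [hprojr r hr.1.le (hr.2.le.trans (hmem.1 τ.2).2)]
      rw [← h2]
      exact h1

end Model

end DynamicPersuasion

end

/-- First-order characterization of the reduced persuasion problem. -/
theorem theorem1 {Θ A : Type*} [Fintype Θ] (M : DynamicPersuasion.Model Θ A) :
    -- sufficiency
    (Measurable (fun p : M.D => M.V p.1 p.2) →
      ∀ f ∈ M.consistent, M.Obedient f →
        (∃ (Λ : FiniteMeasure M.Tcirc) (γ : M.Tcirc → Θ → ℝ) (a : Θ → ℝ),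
          M.IsSelection f Λ γ ∧ M.FOC f Λ γ a ∧ M.lagrangian f Λ = M.payoff f) →
        M.Solves f) ∧
    -- necessity
    ((M.T.Finite ∨ ∃ b c : ℝ, M.T = Icc b c) →
      (∀ θ, 0 < M.prior θ) →
      M.InfoValuable → (M.T.Finite → M.WaitingValuable) → M.Continuity →
      ∀ f, M.Solves f →
        ∃ (Λ : FiniteMeasure M.Tcirc) (γ : M.Tcirc → Θ → ℝ) (a : Θ → ℝ),
          M.SolvesDual Λ ∧ M.lagrangian f Λ = M.payoff f ∧
          M.IsSelection f Λ γ ∧ M.FOC f Λ γ a ∧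
          (∀ p ∈ (f : Measure M.D).support,
            M.T.Finite ∨ (Λ : Measure M.Tcirc) {τ | (τ : M.T) = p.2} = 0 →
            M.deriv Λ γ p = ∑ θ, a θ * p.1 θ)) := by
  refine ⟨fun hV f hf hob ⟨Λ, γ, a, hγ, hfoc, hcs⟩ =>
      DynamicPersuasion.Model.solves_of_FOC hV hf hob hγ hfoc hcs,
    fun hT hfull hinfo hwait hcont f hf => ?_⟩
  have hslater : M.Slater := by
    by_cases hfin : M.T.Finite
    · exact DynamicPersuasion.Model.slater_of_finite hfin (hwait hfin)
    · obtain ⟨b, c, hbc⟩ := hT.resolve_left hfin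
      exact DynamicPersuasion.Model.slater_of_interval hbc hinfo hcont
  obtain ⟨a, lam, Γ, hmult, ha⟩ := DynamicPersuasion.Model.exists_isMultiplier hfull hslater hf
  obtain ⟨Λ, γ, hγ, hle, hderiv⟩ : ∃ (Λ : FiniteMeasure M.Tcirc) (γ : M.Tcirc → Θ → ℝ),
      (∀ θ, Integrable (fun t => γ t θ) (Λ : Measure M.Tcirc)) ∧
      (∀ᵐ t ∂(Λ : Measure M.Tcirc), ∀ y : Θ → ℝ, (∀ θ, 0 ≤ y θ) →
        ∑ θ, γ t θ * y θ ≤ M.U y t) ∧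
      ∀ p : M.D, M.deriv Λ γ p ≤ ∑ θ, a θ * p.1 θ := by
    rcases hT with hfin | ⟨b, c, hbc⟩
    · exact hmult.exists_measure_of_finite hfin
    · exact hmult.exists_measure_of_interval hbc hcont
  exact DynamicPersuasion.Model.conclusion_of_multipliers hcont hf.1 hf.2.1 hγ hle hderiv ha.le
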